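/- Let $k$ be a field. For a quiver $Q$ with finite vertex set $Q_0$ and $I\subseteq Q_0$, let $Q|_I$ be the full subquiver on $I$; representations are finite dimensional over $k$, and $\underline{\dim}\,M\in\mathbb{R}^{Q_0}$ is the dimension vector of $M$. A *tilting module* over $Q$ is a direct sum $T=\bigoplus_i T(i)$ of $|Q_0|$ pairwise non-isomorphic indecomposable representations with $\mathrm{Ext}^1(T,T)=0$. A *support tilting module* is a direct sum of indecomposables that is a tilting module when restricted to the full subquiver on its support. A *2-support tilting module* is a module $T=T^+\oplus T^-$ with $T^+,T^-$ support tilting modules such that $Q_0$ is the disjoint union of their supports. Let - $P^+(Q)$ be the union of the simplices $\mathrm{conv}\{0,\underline{\dim}\,T(i)\}$ over all tilting modules $T$, - $P^{\mathrm{clus}}(Q)$ be the union of the simplices $\mathrm{conv}\{0,\underline{\dim}\,T(i),-e_j \mid j\notin\mathrm{supp}\,T\}$ over all support tilting modules $T$, - $P(Q)$ be the union of the simplices $\mathrm{conv}\{0,\underline{\dim}\,T^+(i),-\underline{\dim}\,T^-(j)\}$ over all 2-support tilting modules $T=T^+\oplus T^-$, and let $t^+(Q)$, $t^{\mathrm{clus}}(Q)$,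 $t(Q)$ be the volumes of $P^+(Q)$, $P^{\mathrm{clus}}(Q)$, $P(Q)$, where the volume on $\mathbb{R}^{Q_0}$ is $|Q_0|!$ times the Lebesgue measure. For every $m\ge 0$ let $\mathbb{A}_m$ denote a quiver of type $\mathbb{A}$ with $m$ vertices, with an arbitrary orientation chosen independently for each $m$. Then for every $n\ge 1$, with $Q_0$ the vertex set of $\mathbb{A}_n$, $$t(\mathbb{A}_n)=\sum_{I\subseteq Q_0}t^+(\mathbb{A}_n|_I)\,t^+(\mathbb{A}_n|_{Q_0\setminus I}),$$ $$t^{\mathrm{clus}}(\mathbb{A}_n)=\sum_{I\subseteq Q_0}t^+(\mathbb{A}_n|_{Q_0\setminus I})=\sum_{i=0}^{n}t^+(\mathbb{A}_i)\,t^+(\mathbb{A}_{n-i}),$$ $$t^+(\mathbb{A}_n)=\sum_{i\in Q_0}t^+(\mathbb{A}_n|_{Q_0\setminus\{i\}})=\sum_{i=0}^{n-1}t^+(\mathbb{A}_i)\,t^+(\mathbb{A}_{n-1-i}).$$ -/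

import Mathlib

open MeasureTheory

open scoped ENNReal

noncomputable section

universe u v w

/-- The full subquiver `Q|_S` of a quiver `Q` on a set `S` of vertices. -/
@[reducible] def fullSubquiver {V : Type v} (Q : Quiver.{w} V) (S : Set V) : Quiver.{w} S where
  Hom x y := @Quiver.Hom V Q x y

/-- The quiver of type `A_n` on the vertices `0, …, n - 1` in which the edge between `i` and `i + 1`
is oriented by `o i`: it is an arrow `i → i + 1` if `o i = true`, and an arrow `i + 1 → i` if
`o i = false`. Only the values `o i` with `i + 1 < n` matter. -/
@[reducible] def typeA (n : ℕ) (o : ℕ → Bool) : Quiver.{0} (Fin n) where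
  Hom i j := PLift (((i : ℕ) + 1 = j ∧ o i = true) ∨ ((j : ℕ) + 1 = i ∧ o j = false))

/-- A finite dimensional representation of the quiver `Q` over the field `k`. -/
structure QuiverRep (k : Type u) [Field k] {V : Type v} (Q : Quiver.{w} V) where
  space : V → Type u
  [addCommGroup : ∀ x, AddCommGroup (space x)]
  [module : ∀ x, Module k (space x)]
  [finiteDimensional : ∀ x, FiniteDimensional k (space x)]
  map : ∀ {x y : V}, @Quiver.Hom V Q x y → (space x →ₗ[k] space y)

attribute [instance] QuiverRep.addCommGroup QuiverRep.module QuiverRep.finiteDimensional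

namespace QuiverRep

variable {k : Type u} [Field k] {V : Type v} {Q : Quiver.{w} V}

/-- Two representations are isomorphic. -/
def Isomorphic (M N : QuiverRep k Q) : Prop :=
  ∃ e : ∀ x, M.space x ≃ₗ[k] N.space x,
    ∀ (x y : V) (a : @Quiver.Hom V Q x y) (m : M.space x), e y (M.map a m) = N.map a (e x m)

/-- The zero representation. -/
def IsZero (M : QuiverRep k Q) : Prop := ∀ x, Subsingleton (M.space x)

/-- The direct sum of two representations. -/
def prod (M N : QuiverRep k Q) : QuiverRep k Q where
  space x := M.space x × N.space x
  map a := (M.map a).prodMap (N.map a)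

/-- The direct sum of a finite family of representations. -/
def directSum {ι : Type} [Finite ι] (T : ι → QuiverRep k Q) : QuiverRep k Q where
  space x := ∀ i, (T i).space x
  map a := LinearMap.pi fun i => (T i).map a ∘ₗ LinearMap.proj i

/-- `M` is nonzero and has no decomposition into a direct sum of two nonzero representations. -/
def Indecomposable (M : QuiverRep k Q) : Prop :=
  ¬ M.IsZero ∧ ∀ A B : QuiverRep k Q, M.Isomorphic (A.prod B) → A.IsZero ∨ B.IsZero

/-- The restriction of a representation to a full subquiver. -/
def restrict (M : QuiverRep k Q) (S : Set V) : QuiverRep k (fullSubquiver Q S) where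
  space x := M.space x
  map {x y} a := M.map (x := (x : V)) (y := (y : V)) a

/-- The dimension vector, as a point of `ℝ^V`. -/
def dimVec (M : QuiverRep k Q) : V → ℝ := fun x => (Module.finrank k (M.space x) : ℝ)

/-- The map `Hom(P⁰, W) → Hom(P¹, W)` induced by the standard projective resolution
`0 → P¹ → P⁰ → M → 0`, where `P⁰ = ⨁_x P(x) ⊗ M_x` and `P¹ = ⨁_{a : x → y} P(y) ⊗ M_x`, under the
identifications `Hom(P⁰, W) = ∏_x Hom(M_x, W_x)` and `Hom(P¹, W) = ∏_{a : x → y} Hom(M_x, W_y)`. -/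
def extMap (M W : QuiverRep k Q) :
    (∀ x, M.space x →ₗ[k] W.space x) →ₗ[k]
      (∀ (x y : V), @Quiver.Hom V Q x y → (M.space x →ₗ[k] W.space y)) where
  toFun f := fun x y a => W.map a ∘ₗ f x - f y ∘ₗ M.map a
  map_add' f g := by
    funext x y a
    ext m
    simp only [Pi.add_apply, LinearMap.sub_apply, LinearMap.comp_apply, LinearMap.add_apply,
      map_add]
    abel
  map_smul' c f := by
    funext x y a
    ext m
    simp [smul_sub]

/-- `Ext¹(M, W)`, the cokernel of `Hom(P⁰, W) → Hom(P¹, W)`. -/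
abbrev Ext1 (M W : QuiverRep k Q) : Type _ :=
  (∀ (x y : V), @Quiver.Hom V Q x y → (M.space x →ₗ[k] W.space y)) ⧸ LinearMap.range (extMap M W)

/-- The family `T` consists of the indecomposable direct summands of a (basic) tilting module:
`⨁ T i` is a direct sum of `n` pairwise non-isomorphic indecomposable representations without self
extensions, where `n` is the number of vertices. -/
structure IsTilting {m : ℕ} (T : Fin m → QuiverRep k Q) : Prop where
  card_eq : m = Nat.card V
  indecomposable : ∀ i, (T i).Indecomposable
  pairwise_not_isomorphic : ∀ i j, i ≠ j → ¬ (T i).Isomorphic (T j)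
  rigid : Subsingleton (Ext1 (directSum T) (directSum T))

/-- The support of the module `⨁ T i`: the union of the supports of the `T i`. -/
def supp {m : ℕ} (T : Fin m → QuiverRep k Q) : Set V :=
  {x | ∃ i, Nontrivial ((T i).space x)}

/-- `⨁ T i` is a tilting module if restricted to its support. -/
def IsSupportTilting {m : ℕ} (T : Fin m → QuiverRep k Q) : Prop :=
  IsTilting fun i => (T i).restrict (supp T)

end QuiverRep

section Polytopes

open QuiverRep

variable (k : Type u) [Field k] {V : Type v} (Q : Quiver.{w} V)

/-- `P⁺(Q)`: the union of the simplices `σ_T = conv {dim T i, 0}` over all tilting modules `T`. -/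
def PPlus : Set (V → ℝ) :=
  {p | ∃ (m : ℕ) (T : Fin m → QuiverRep k Q), IsTilting T ∧
    p ∈ convexHull ℝ (insert 0 (Set.range fun i => (T i).dimVec))}

/-- `P^clus(Q)`: the union of the simplices `σ_T = conv {dim T i, -e_j, 0}` over all support tilting
modules `T`, where `j` runs over the vertices outside the support of `T`. -/
def PClus [DecidableEq V] : Set (V → ℝ) :=
  {p | ∃ (m : ℕ) (T : Fin m → QuiverRep k Q), IsSupportTilting T ∧
    p ∈ convexHull ℝ (insert 0
      ((Set.range fun i => (T i).dimVec) ∪ (fun j => -Pi.single j (1 : ℝ)) '' (supp T)ᶜ))}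

/-- `P(Q)`: the union of the simplices `σ_T = conv {dim T⁺ i, -dim T⁻ j, 0}` over all 2-support
tilting modules `T = T⁺ ⊕ T⁻`, that is, `T⁺` and `T⁻` are support tilting modules and the set of
vertices is the disjoint union of their supports. -/
def PFull : Set (V → ℝ) :=
  {p | ∃ (m l : ℕ) (Tp : Fin m → QuiverRep k Q) (Tm : Fin l → QuiverRep k Q),
    IsSupportTilting Tp ∧ IsSupportTilting Tm ∧ IsCompl (supp Tp) (supp Tm) ∧
    p ∈ convexHull ℝ (insert 0
      ((Set.range fun i => (Tp i).dimVec) ∪ Set.range fun j => -(Tm j).dimVec))}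

variable [Fintype V]

/-- The integral volume on `ℝ^V`: `n!` times the Lebesgue measure, where `n` is the number of
elements of `V`. -/
def integralVolume (S : Set (V → ℝ)) : ℝ≥0∞ :=
  (Nat.factorial (Fintype.card V) : ℝ≥0∞) * volume S

/-- `t⁺(Q) = vol P⁺(Q)`. -/
def tPlus : ℝ≥0∞ := integralVolume (PPlus k Q)

/-- `t^clus(Q) = vol P^clus(Q)`. -/
def tClus [DecidableEq V] : ℝ≥0∞ := integralVolume (PClus k Q)

/-- `t(Q) = vol P(Q)`. -/
def tFull : ℝ≥0∞ := integralVolume (PFull k Q)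

end Polytopes

end

/-!
In a linear quiver an indecomposable representation is thin and supported on an interval: a
rank one idempotent endomorphism exists, because linear relations along a line transport a vector
together with a compatible functional from one end to the other. Call `∑ (d i - d (i + 1))⁺` the
drop sum of `d`. It is `1` on intervals, and it is linear on the cone spanned by a tilting module,
since `Ext¹ = 0` makes the summands either all increase or all decrease along each arrow. These
cones fill the nonnegative orthant, so `P⁺` is the part of it where the drop sum is at most `1`,
whatever the orientation; likewise for `P` and `P^clus`, with the positive and the negative part of
a vector treated separately.

As the drop sum is homogeneous, `n!` times the volume of `P⁺` is the integral of `exp (-drop sum)`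
over the nonnegative orthant, and similarly for `P` and `P^clus`. Such integrals split:
* cutting `ℝⁿ` into orthants gives the sums over subsets for `t` and `t^clus`;
* subtracting the least entry, at the place `i`, from all entries leaves a vector on the complement
  of `i` and factors `exp (-least entry)` out, which gives the recursion for `t⁺`;
* `t⁺` is multiplicative over the connected components of a subset, so the sum for `t^clus` is
  determined by the Catalan recursion, by removing the last vertex not in the subset.
-/

namespace QuiverRep

variable {k : Type u} [Field k] {V : Type v} {Q : Quiver.{w} V}

section Ext

theorem subsingleton_ext1_iff {M N : QuiverRep k Q} :
    Subsingleton (Ext1 M N) ↔ Function.Surjective (extMap M N) := by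
  rw [Submodule.Quotient.subsingleton_iff, LinearMap.range_eq_top]

theorem extMap_apply {M N : QuiverRep k Q} (f : ∀ x, M.space x →ₗ[k] N.space x) {x y : V}
    (a : Q.Hom x y) (m : M.space x) :
    extMap M N f x y a m = N.map a (f x m) - f y (M.map a m) := rfl

theorem extMap_eq_iff {M N : QuiverRep k Q} {f : ∀ x, M.space x →ₗ[k] N.space x}
    {g : ∀ x y, Q.Hom x y → (M.space x →ₗ[k] N.space y)} :
    extMap M N f = g ↔
      ∀ x y (a : Q.Hom x y) m, N.map a (f x m) - f y (M.map a m) = g x y a m :=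
  ⟨fun h x y a m => by rw [← h, extMap_apply],
    fun h => funext fun x => funext fun y => funext fun a => LinearMap.ext (h x y a)⟩

theorem extMap_surjective_directSum_right {ι : Type} [Finite ι] {M : QuiverRep k Q}
    {T : ι → QuiverRep k Q} :
    Function.Surjective (extMap M (directSum T)) ↔
      ∀ j, Function.Surjective (extMap M (T j)) := by
  classical
  refine ⟨fun h j g => ?_, fun h g => ?_⟩
  · obtain ⟨f, hf⟩ := h fun x y a => LinearMap.single k (fun l => (T l).space y) j ∘ₗ g x y a
    refine ⟨fun x => LinearMap.proj j ∘ₗ f x, extMap_eq_iff.2 fun x y a m => ?_⟩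
    exact (congrFun (extMap_eq_iff.1 hf x y a m) j).trans
      (Pi.single_eq_same (M := fun l => (T l).space y) j (g x y a m))
  · choose f hf using fun j => h j fun x y a => LinearMap.proj j ∘ₗ g x y a
    exact ⟨fun x => LinearMap.pi fun j => f j x,
      extMap_eq_iff.2 fun x y a m => funext fun j => extMap_eq_iff.1 (hf j) x y a m⟩

theorem extMap_surjective_directSum_left {ι : Type} [Finite ι] {T : ι → QuiverRep k Q}
    {N : QuiverRep k Q} :
    Function.Surjective (extMap (directSum T) N) ↔
      ∀ i, Function.Surjective (extMap (T i) N) := by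
  classical
  have := Fintype.ofFinite ι
  have map_single (i : ι) {x y : V} (a : Q.Hom x y) (m : (T i).space x) :
      (directSum T).map a (Pi.single (M := fun l => (T l).space x) i m) =
        Pi.single (M := fun l => (T l).space y) i ((T i).map a m) :=
    funext fun l => Pi.apply_single (fun l => (T l).map a) (fun l => map_zero _) i m l
  refine ⟨fun h i g => ?_, fun h g => ?_⟩
  · obtain ⟨f, hf⟩ := h fun x y a => g x y a ∘ₗ (LinearMap.proj i : (∀ l, (T l).space x) →ₗ[k] _)
    refine ⟨fun x => f x ∘ₗ LinearMap.single k (fun l => (T l).space x) i,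
      extMap_eq_iff.2 fun x y a m => ?_⟩
    have hm := extMap_eq_iff.1 hf x y a (Pi.single (M := fun l => (T l).space x) i m)
    rw [map_single] at hm
    exact hm.trans (congrArg (g x y a) (Pi.single_eq_same (M := fun l => (T l).space x) i m))
  · choose f hf using fun i => h i fun x y a =>
      g x y a ∘ₗ LinearMap.single k (fun l => (T l).space x) i
    refine ⟨fun x => LinearMap.lsum k (fun l => (T l).space x) k fun i => f i x,
      funext fun x => funext fun y => funext fun a => LinearMap.pi_ext fun i m => ?_⟩
    change N.map a (LinearMap.lsum k _ k (fun i => f i x) (Pi.single i m)) -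
      LinearMap.lsum k _ k (fun i => f i y)
        ((directSum T).map a (Pi.single (M := fun l => (T l).space x) i m)) = _
    rw [map_single, LinearMap.lsum_piSingle, LinearMap.lsum_piSingle]
    exact extMap_eq_iff.1 (hf i) x y a m

theorem subsingleton_ext1_directSum_iff {ι : Type} [Finite ι] {T : ι → QuiverRep k Q} :
    Subsingleton (Ext1 (directSum T) (directSum T)) ↔
      ∀ i j, Function.Surjective (extMap (T i) (T j)) := by
  simp only [subsingleton_ext1_iff, extMap_surjective_directSum_left,
    extMap_surjective_directSum_right]
  exact forall_comm

theorem injective_or_surjective_of_extMap_surjective {M N : QuiverRep k Q}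
    (h : Function.Surjective (extMap M N)) {x y : V} (a : Q.Hom x y) :
    Function.Injective (M.map a) ∨ Function.Surjective (N.map a) := by
  classical
  by_contra! hc
  obtain ⟨m, hm, hm0⟩ : ∃ m, M.map a m = 0 ∧ m ≠ 0 := by
    simpa [injective_iff_map_eq_zero] using hc.1
  obtain ⟨n, hn⟩ : ∃ n, ∀ m, N.map a m ≠ n := by simpa [Function.Surjective] using hc.2
  obtain ⟨ξ, hξ⟩ := Module.Projective.exists_dual_ne_zero k hm0
  obtain ⟨f, hf⟩ := h (Pi.single x (Pi.single y fun _ => ξ.smulRight n))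
  have := extMap_eq_iff.1 hf x y a m
  rw [hm, map_zero, sub_zero, Pi.single_eq_same, Pi.single_eq_same, LinearMap.smulRight_apply]
    at this
  exact hn ((ξ m)⁻¹ • f x m) (by rw [map_smul, this, inv_smul_smul₀ hξ])

end Ext

section Subrepresentation

variable {M : QuiverRep k Q}

/-- The subrepresentation of `M` on a family of subspaces that is stable under the maps of `M`. -/
def ofSubmodule (M : QuiverRep k Q) (W : ∀ x, Submodule k (M.space x))
    (hW : ∀ x y (a : Q.Hom x y), ∀ m ∈ W x, M.map a m ∈ W y) : QuiverRep k Q where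
  space x := W x
  map {x y} a := (M.map a).restrict (hW x y a)

theorem isomorphic_prod_ofSubmodule {W W' : ∀ x, Submodule k (M.space x)}
    (hW : ∀ x y (a : Q.Hom x y), ∀ m ∈ W x, M.map a m ∈ W y)
    (hW' : ∀ x y (a : Q.Hom x y), ∀ m ∈ W' x, M.map a m ∈ W' y)
    (h : ∀ x, IsCompl (W x) (W' x)) :
    M.Isomorphic ((M.ofSubmodule W hW).prod (M.ofSubmodule W' hW')) := by
  refine ⟨fun x => (Submodule.prodEquivOfIsCompl _ _ (h x)).symm, fun x y a m => ?_⟩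
  obtain ⟨m, rfl⟩ := (Submodule.prodEquivOfIsCompl _ _ (h x)).surjective m
  have key : (Submodule.prodEquivOfIsCompl _ _ (h y)).symm
      (M.map a (Submodule.prodEquivOfIsCompl _ _ (h x) m)) =
        ((M.ofSubmodule W hW).map a m.1, (M.ofSubmodule W' hW').map a m.2) :=
    (LinearEquiv.symm_apply_eq _).2 (map_add (M.map a) (m.1 : M.space x) m.2)
  refine key.trans (congrArg (((M.ofSubmodule W hW).prod (M.ofSubmodule W' hW')).map a) ?_)
  exact (LinearEquiv.symm_apply_apply _ m).symm

theorem Indecomposable.eq_bot_or_eq_bot (hM : M.Indecomposable)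
    {W W' : ∀ x, Submodule k (M.space x)}
    (hW : ∀ x y (a : Q.Hom x y), ∀ m ∈ W x, M.map a m ∈ W y)
    (hW' : ∀ x y (a : Q.Hom x y), ∀ m ∈ W' x, M.map a m ∈ W' y)
    (h : ∀ x, IsCompl (W x) (W' x)) : (∀ x, W x = ⊥) ∨ ∀ x, W' x = ⊥ :=
  (hM.2 _ _ (isomorphic_prod_ofSubmodule hW hW' h)).imp
    (fun h x => Submodule.subsingleton_iff_eq_bot.1 (h x))
    fun h x => Submodule.subsingleton_iff_eq_bot.1 (h x)

theorem Indecomposable.eq_zero_or_eq_id (hM : M.Indecomposable)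
    {e : ∀ x, M.space x →ₗ[k] M.space x} (he : ∀ x, IsIdempotentElem (e x))
    (hcomm : extMap M M e = 0) : (∀ x, e x = 0) ∨ ∀ x, e x = LinearMap.id := by
  have hcomm' {x y} (a : Q.Hom x y) (m) : M.map a (e x m) = e y (M.map a m) :=
    sub_eq_zero.1 (extMap_eq_iff.1 hcomm x y a m)
  refine (hM.eq_bot_or_eq_bot (W := fun x => LinearMap.range (e x))
    (W' := fun x => LinearMap.ker (e x)) ?_ ?_ fun x =>
      LinearMap.IsIdempotentElem.isCompl (he x)).imp
    (fun h x => LinearMap.range_eq_bot.1 (h x)) fun h x => LinearMap.ext fun m => ?_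
  · rintro x y a _ ⟨m, rfl⟩
    exact ⟨M.map a m, (hcomm' a m).symm⟩
  · intro x y a m hm
    rw [LinearMap.mem_ker] at hm ⊢
    rw [← hcomm', hm, map_zero]
  · exact LinearMap.ker_eq_bot.1 (h x) (LinearMap.congr_fun (he x) m)

end Subrepresentation

end QuiverRep

section AdaptedPair

variable {k : Type u} [Field k]

/-- The vector `v` and the functional `φ` define a rank one idempotent `m ↦ φ m • v` that preserves
every member of `C`. -/
structure IsAdaptedPair {X : Type v} [AddCommGroup X] [Module k X] (C : Set (Submodule k X))
    (v : X) (φ : Module.Dual k X) : Prop where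
  apply_self : φ v = 1
  smul_mem : ∀ F ∈ C, ∀ m ∈ F, φ m • v ∈ F

variable {X Y : Type v} [AddCommGroup X] [Module k X] [AddCommGroup Y] [Module k Y]
  {C : Set (Submodule k X)}

theorem exists_isAdaptedPair [Nontrivial X] [FiniteDimensional k X] (hC : IsChain (· ≤ ·) C) :
    ∃ v φ, IsAdaptedPair C v φ := by
  have hC' : IsChain (· ≤ ·) (insert ⊤ C) := hC.insert fun _ _ _ => Or.inr le_top
  obtain ⟨F, ⟨hFC, hF⟩, hFmin⟩ := wellFounded_lt.has_min
    {F | F ∈ insert ⊤ C ∧ F ≠ ⊥} ⟨⊤, by simp, top_ne_bot⟩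
  obtain ⟨v, hvF, hv⟩ := (Submodule.ne_bot_iff F).1 hF
  obtain ⟨φ, hφ⟩ := Module.Projective.exists_dual_ne_zero k hv
  refine ⟨v, (φ v)⁻¹ • φ, inv_mul_cancel₀ hφ, fun F' hF' m hm => ?_⟩
  by_cases hbot : F' = ⊥
  · rw [hbot, Submodule.mem_bot] at hm
    simp [hm]
  · have hle : F ≤ F' := (hC'.total hFC (Or.inr hF')).elim id fun hle =>
      (eq_of_le_of_not_lt hle (hFmin F' ⟨Or.inr hF', hbot⟩)).ge
    exact F'.smul_mem _ (hle hvF)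

/-- The preimage of the subspace `F` under the linear relation `R`. -/
def relPreimage (R : Submodule k (Y × X)) (F : Submodule k X) : Submodule k Y :=
  (R ⊓ F.comap (LinearMap.snd k Y X)).map (LinearMap.fst k Y X)

theorem mem_relPreimage {R : Submodule k (Y × X)} {F : Submodule k X} {m : Y} :
    m ∈ relPreimage R F ↔ ∃ w ∈ F, (m, w) ∈ R := by
  simp [relPreimage, and_comm]

theorem relPreimage_mono (R : Submodule k (Y × X)) : Monotone (relPreimage R) :=
  fun _ _ h => Submodule.map_mono (inf_le_inf_left _ (Submodule.comap_mono h))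

theorem isChain_image_relPreimage (hC : IsChain (· ≤ ·) C) (R : Submodule k (Y × X)) :
    IsChain (· ≤ ·) (relPreimage R '' insert ⊥ (insert ⊤ C)) :=
  ((hC.insert fun _ _ _ => Or.inr le_top).insert fun _ _ _ => Or.inl bot_le).image_of_map_rel
    _ _ _ fun _ _ h => relPreimage_mono R h

theorem exists_dual_of_relation {R : Submodule k (Y × X)} {φ : Module.Dual k Y}
    {G : Submodule k X} (h : ∀ m ∈ relPreimage R G, φ m = 0) :
    ∃ ψ : Module.Dual k X, (∀ w ∈ G, ψ w = 0) ∧ ∀ m w, (m, w) ∈ R → ψ w = φ m := by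
  obtain ⟨ψ, hψ⟩ : φ ∘ₗ LinearMap.fst k Y X ∘ₗ R.subtype ∈
      LinearMap.range (G.mkQ ∘ₗ LinearMap.snd k Y X ∘ₗ R.subtype).dualMap := by
    rw [LinearMap.range_dualMap_eq_dualAnnihilator_ker, Submodule.mem_dualAnnihilator]
    rintro ⟨⟨m, w⟩, hR⟩ hw
    exact h m (mem_relPreimage.2 ⟨w, (Submodule.Quotient.mk_eq_zero G).1 hw, hR⟩)
  refine ⟨ψ ∘ₗ G.mkQ, fun w hw => ?_, fun m w hR => LinearMap.congr_fun hψ ⟨(m, w), hR⟩⟩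
  rw [LinearMap.comp_apply, Submodule.mkQ_apply, (Submodule.Quotient.mk_eq_zero G).2 hw, map_zero]

theorem exists_isAdaptedPair_of_relation [FiniteDimensional k X] (hC : IsChain (· ≤ ·) C)
    {R : Submodule k (Y × X)} {v : Y} {φ : Module.Dual k Y}
    (hv : IsAdaptedPair (relPreimage R '' insert ⊥ (insert ⊤ C)) v φ) :
    (∀ m w, (m, w) ∈ R → (φ m • v, (0 : X)) ∈ R) ∨
      ∃ w ψ, IsAdaptedPair C w ψ ∧ ∀ m m', (m, m') ∈ R → (φ m • v, ψ m' • w) ∈ R := by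
  have mem_of {F} (hF : F ∈ insert ⊥ (insert ⊤ C)) {m} (hm : m ∈ relPreimage R F)
      (hφ : φ m ≠ 0) : v ∈ relPreimage R F :=
    ((relPreimage R F).smul_mem_iff hφ).1 (hv.smul_mem _ ⟨F, hF, rfl⟩ m hm)
  by_cases hD : v ∈ relPreimage R ⊥ ∨ v ∉ relPreimage R ⊤
  · refine Or.inl fun m w hR => ?_
    by_cases hφ : φ m = 0
    · rw [hφ, zero_smul]
      exact R.zero_mem
    · have hv : v ∈ relPreimage R ⊥ := hD.resolve_right fun h =>
        h (mem_of (by simp) (mem_relPreimage.2 ⟨w, trivial, hR⟩) hφ)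
      obtain ⟨_, rfl, hv⟩ := mem_relPreimage.1 hv
      simpa using R.smul_mem (φ m) hv
  push Not at hD
  obtain ⟨F, ⟨hFC, hF⟩, hFmin⟩ := wellFounded_lt.has_min
    {F | F ∈ insert ⊤ C ∧ v ∈ relPreimage R F} ⟨⊤, by simp, hD.2⟩
  obtain ⟨G, ⟨hGC, hG⟩, hGmax⟩ := wellFounded_gt.has_min
    {G | G ∈ insert ⊥ C ∧ v ∉ relPreimage R G} ⟨⊥, by simp, hD.1⟩
  obtain ⟨w, hwF, hw⟩ := mem_relPreimage.1 hF
  obtain ⟨ψ, hψG, hψ⟩ := exists_dual_of_relation (R := R) (φ := φ) (G := G) fun m hm =>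
    by_contra fun hφ => hG (mem_of (by grind) hm hφ)
  refine Or.inr ⟨w, ψ, ⟨(hψ _ _ hw).trans hv.apply_self, fun F' hF' m hm => ?_⟩,
    fun m m' hR => hψ m m' hR ▸ R.smul_mem (φ m) hw⟩
  by_cases h : v ∈ relPreimage R F'
  · have hle : F ≤ F' := ((hC.insert fun _ _ _ => Or.inr le_top).total hFC (Or.inr hF')).elim id
      fun hle => (eq_of_le_of_not_lt hle (hFmin F' ⟨Or.inr hF', h⟩)).ge
    exact F'.smul_mem _ (hle hwF)
  · have hle : F' ≤ G := ((hC.insert fun _ _ _ => Or.inl bot_le).total (Or.inr hF') hGC).elim id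
      fun hle => (eq_of_le_of_not_lt hle (hGmax F' ⟨Or.inr hF', h⟩)).ge
    rw [hψG m (hle hm), zero_smul]
    exact F'.zero_mem

end AdaptedPair

section AdaptedSequence

variable {k : Type u} [Field k] {X : ℕ → Type v} [∀ i, AddCommGroup (X i)] [∀ i, Module k (X i)]

/-- Rank one idempotents `m ↦ φ i m • v i` for `r ≤ i ≤ s`, extended by zero, which preserve the
members of `C` and the linear relations `R i` with `i < s`. -/
structure IsAdaptedSequence (R : ∀ i, Submodule k (X (i + 1) × X i)) (C : Set (Submodule k (X 0)))
    (r s : ℕ) (v : ∀ i, X i) (φ : ∀ i, Module.Dual k (X i)) : Prop where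
  apply_self : ∀ i, r ≤ i → i ≤ s → φ i (v i) = 1
  eq_zero : ∀ i, ¬ (r ≤ i ∧ i ≤ s) → v i = 0 ∧ φ i = 0
  smul_mem : ∀ F ∈ C, ∀ m ∈ F, φ 0 m • v 0 ∈ F
  smul_mem_relation : ∀ i < s, ∀ m w, (m, w) ∈ R i → (φ (i + 1) m • v (i + 1), φ i w • v i) ∈ R i

variable {R : ∀ i, Submodule k (X (i + 1) × X i)} {C : Set (Submodule k (X 0))}
  {D : Set (Submodule k (X 1))} {r s : ℕ} {v : ∀ i, X (i + 1)} {φ : ∀ i, Module.Dual k (X (i + 1))}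

theorem IsAdaptedSequence.exists_succ_succ
    (h : IsAdaptedSequence (X := fun i => X (i + 1)) (fun i => R (i + 1)) D r s v φ)
    (hR : ∀ m w, (m, w) ∈ R 0 → (φ 0 m • v 0, (0 : X 0)) ∈ R 0) :
    ∃ v' φ', IsAdaptedSequence R C (r + 1) (s + 1) v' φ' := by
  refine ⟨fun | 0 => 0 | i + 1 => v i, fun | 0 => 0 | i + 1 => φ i, ?_, ?_,
    fun F _ m _ => by simp, ?_⟩
  · rintro (_ | i) hi his
    exacts [absurd hi (by simp), h.apply_self i (by lia) (by lia)]
  · rintro (_ | i) hi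
    exacts [⟨rfl, rfl⟩, h.eq_zero i (by lia)]
  · rintro (_ | i) hi m w hmw
    exacts [by simpa using hR m w hmw, h.smul_mem_relation i (by lia) m w hmw]

theorem IsAdaptedSequence.exists_zero_succ
    (h : IsAdaptedSequence (X := fun i => X (i + 1)) (fun i => R (i + 1)) D 0 s v φ)
    {w : X 0} {ψ : Module.Dual k (X 0)} (hw : IsAdaptedPair C w ψ)
    (hR : ∀ m m', (m, m') ∈ R 0 → (φ 0 m • v 0, ψ m' • w) ∈ R 0) :
    ∃ v' φ', IsAdaptedSequence R C 0 (s + 1) v' φ' := by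
  refine ⟨fun | 0 => w | i + 1 => v i, fun | 0 => ψ | i + 1 => φ i, ?_, ?_, hw.smul_mem, ?_⟩
  · rintro (_ | i) - hi
    exacts [hw.apply_self, h.apply_self i (by lia) (by lia)]
  · rintro (_ | i) hi
    exacts [absurd ⟨le_rfl, by lia⟩ hi, h.eq_zero i (by lia)]
  · rintro (_ | i) hi m m' hmm
    exacts [hR m m' hmm, h.smul_mem_relation i (by lia) m m' hmm]

theorem exists_isAdaptedSequence (s : ℕ) :
    ∀ {X : ℕ → Type v} [∀ i, AddCommGroup (X i)] [∀ i, Module k (X i)]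
      [∀ i, FiniteDimensional k (X i)] [Nontrivial (X s)]
      (R : ∀ i, Submodule k (X (i + 1) × X i)) {C : Set (Submodule k (X 0))},
      IsChain (· ≤ ·) C → ∃ r ≤ s, ∃ v φ, IsAdaptedSequence R C r s v φ := by
  induction s with
  | zero =>
    intro X _ _ _ _ R C hC
    obtain ⟨v, φ, h⟩ := exists_isAdaptedPair hC
    refine ⟨0, le_rfl, fun | 0 => v | _ + 1 => 0, fun | 0 => φ | _ + 1 => 0, ?_, ?_, h.smul_mem,
      fun i hi => absurd hi (Nat.not_lt_zero i)⟩
    · rintro (_ | i) - hi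
      exacts [h.apply_self, absurd hi (by simp)]
    · rintro (_ | i) hi
      exacts [absurd ⟨le_rfl, le_rfl⟩ hi, ⟨rfl, rfl⟩]
  | succ s ih =>
    intro X _ _ _ _ R C hC
    obtain ⟨r, hrs, v, φ, h⟩ := ih (X := fun i => X (i + 1)) (fun i => R (i + 1))
      (isChain_image_relPreimage hC (R 0))
    by_cases hR : ∀ m w, (m, w) ∈ R 0 → (φ 0 m • v 0, (0 : X 0)) ∈ R 0
    · exact ⟨r + 1, by lia, h.exists_succ_succ hR⟩
    · obtain rfl : r = 0 := by
        by_contra hr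
        refine hR fun m w _ => ?_
        rw [(h.eq_zero 0 (by lia)).1, smul_zero]
        exact (R 0).zero_mem
      obtain ⟨w, ψ, hw, hR⟩ := (exists_isAdaptedPair_of_relation hC
        ⟨h.apply_self 0 le_rfl hrs, h.smul_mem⟩).resolve_left hR
      exact ⟨0, by lia, h.exists_zero_succ hw hR⟩

end AdaptedSequence

section Linear

/-- A quiver whose vertices are placed injectively at positions in `ℕ`, with exactly one arrow
between vertices at neighbouring positions, oriented by `o`, and no other arrows. -/
structure IsLinear {V : Type v} (Q : Quiver.{w} V) (o : ℕ → Bool) (pos : V → ℕ) : Prop where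
  injective : Function.Injective pos
  subsingleton : ∀ x y, Subsingleton (Q.Hom x y)
  nonempty_iff : ∀ x y, Nonempty (Q.Hom x y) ↔
    (pos x + 1 = pos y ∧ o (pos x) = true) ∨ (pos y + 1 = pos x ∧ o (pos y) = false)

theorem isLinear_typeA (n : ℕ) (o : ℕ → Bool) : IsLinear (typeA n o) o (fun i => (i : ℕ)) where
  injective := Fin.val_injective
  subsingleton _ _ := inferInstanceAs (Subsingleton (PLift _))
  nonempty_iff _ _ := ⟨fun ⟨⟨h⟩⟩ => h, fun h => ⟨⟨h⟩⟩⟩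

variable {V : Type v} {Q : Quiver.{w} V} {o : ℕ → Bool} {pos : V → ℕ}

theorem IsLinear.fullSubquiver (hQ : IsLinear Q o pos) (S : Set V) :
    IsLinear (fullSubquiver Q S) o (fun x => pos x) where
  injective := hQ.injective.comp Subtype.val_injective
  subsingleton x y := hQ.subsingleton x y
  nonempty_iff x y := hQ.nonempty_iff x y

theorem IsLinear.pos_eq (hQ : IsLinear Q o pos) {x y : V} (a : Q.Hom x y) :
    (pos x + 1 = pos y ∧ o (pos x) = true) ∨ (pos y + 1 = pos x ∧ o (pos y) = false) :=
  (hQ.nonempty_iff x y).1 ⟨a⟩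

end Linear

namespace QuiverRep

section Indecomposable

variable {k : Type u} [Field k] {V : Type v} {Q : Quiver.{w} V} {o : ℕ → Bool} {pos : V → ℕ}

/-- The value of `M` at position `i`: it is zero if no vertex is placed there. -/
abbrev positionSpace (M : QuiverRep k Q) (pos : V → ℕ) (i : ℕ) : Type (max u v) :=
  ∀ x : {x // pos x = i}, M.space x

/-- The graph of the arrow between the positions `i` and `i + 1`, whatever its orientation. -/
def arrowRelation (M : QuiverRep k Q) (pos : V → ℕ) (i : ℕ) :
    Submodule k (M.positionSpace pos (i + 1) × M.positionSpace pos i) where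
  carrier := {p | (∀ x y (a : Q.Hom x.1 y.1), M.map a (p.2 x) = p.1 y) ∧
    ∀ x y (a : Q.Hom y.1 x.1), M.map a (p.1 y) = p.2 x}
  add_mem' hp hq := ⟨fun x y a => by simp [hp.1 x y a, hq.1 x y a],
    fun x y a => by simp [hp.2 x y a, hq.2 x y a]⟩
  zero_mem' := by simp
  smul_mem' c p hp := ⟨fun x y a => by simp [hp.1 x y a], fun x y a => by simp [hp.2 x y a]⟩

/-- The value at position `pos x` is the space at `x`. -/
def positionEquiv (M : QuiverRep k Q) (hpos : Function.Injective pos) (x : V) {i : ℕ}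
    (hx : pos x = i) : M.positionSpace pos i ≃ₗ[k] M.space x :=
  letI : Unique {y // pos y = i} :=
    ⟨⟨⟨x, hx⟩⟩, fun y => Subtype.ext (hpos (y.2.trans hx.symm))⟩
  LinearEquiv.piUnique k fun y : {y // pos y = i} => M.space y

theorem mem_arrowRelation_of_left {M : QuiverRep k Q} (hQ : IsLinear Q o pos) {x y : V} {i : ℕ}
    (hx : pos x = i) (hy : pos y = i + 1) (a : Q.Hom x y)
    {p : M.positionSpace pos (i + 1) × M.positionSpace pos i} :
    p ∈ M.arrowRelation pos i ↔ M.map a (p.2 ⟨x, hx⟩) = p.1 ⟨y, hy⟩ := by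
  refine ⟨fun hp => hp.1 ⟨x, hx⟩ ⟨y, hy⟩ a, fun hp => ⟨?_, ?_⟩⟩ <;> rintro ⟨x', hx'⟩ ⟨y', hy'⟩ b <;>
    obtain rfl := hQ.injective (hx.trans hx'.symm) <;>
    obtain rfl := hQ.injective (hy.trans hy'.symm)
  · rwa [(hQ.subsingleton x y).elim b a]
  · grind [hQ.pos_eq a, hQ.pos_eq b]

theorem mem_arrowRelation_of_right {M : QuiverRep k Q} (hQ : IsLinear Q o pos) {x y : V} {i : ℕ}
    (hx : pos x = i + 1) (hy : pos y = i) (a : Q.Hom x y)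
    {p : M.positionSpace pos (i + 1) × M.positionSpace pos i} :
    p ∈ M.arrowRelation pos i ↔ M.map a (p.1 ⟨x, hx⟩) = p.2 ⟨y, hy⟩ := by
  refine ⟨fun hp => hp.2 ⟨y, hy⟩ ⟨x, hx⟩ a, fun hp => ⟨?_, ?_⟩⟩ <;> rintro ⟨y', hy'⟩ ⟨x', hx'⟩ b <;>
    obtain rfl := hQ.injective (hx.trans hx'.symm) <;>
    obtain rfl := hQ.injective (hy.trans hy'.symm)
  · grind [hQ.pos_eq a, hQ.pos_eq b]
  · rwa [(hQ.subsingleton x y).elim b a]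

theorem exists_position_maximal {M : QuiverRep k Q} (hM : ¬ M.IsZero) {n : ℕ}
    (hn : ∀ x, pos x < n) :
    ∃ z, Nontrivial (M.space z) ∧ ∀ x, pos z < pos x → Subsingleton (M.space x) := by
  obtain ⟨x, hx⟩ : ∃ x, Nontrivial (M.space x) := by
    simpa [IsZero, not_subsingleton_iff_nontrivial] using hM
  obtain ⟨_, ⟨⟨z, hz, rfl⟩, hmax⟩⟩ : ∃ i, IsGreatest (pos '' {x | Nontrivial (M.space x)}) i :=
    BddAbove.exists_isGreatest_of_nonempty ⟨n, by rintro _ ⟨x, -, rfl⟩; exact (hn x).le⟩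
      ⟨_, x, hx, rfl⟩
  exact ⟨z, hz, fun x hx => not_nontrivial_iff_subsingleton.1 fun h =>
    hx.not_ge (hmax ⟨x, h, rfl⟩)⟩

theorem extMap_smulRight_positionEquiv_eq_zero (hQ : IsLinear Q o pos) {M : QuiverRep k Q} {z : V}
    (hz : ∀ x, pos z < pos x → Subsingleton (M.space x))
    {C : Set (Submodule k (M.positionSpace pos 0))} {r : ℕ} {v : ∀ i, M.positionSpace pos i}
    {φ : ∀ i, Module.Dual k (M.positionSpace pos i)}
    (h : IsAdaptedSequence (M.arrowRelation pos) C r (pos z) v φ) :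
    extMap M M (fun x => (φ (pos x) ∘ₗ (M.positionEquiv hQ.injective x rfl).symm).smulRight
      (M.positionEquiv hQ.injective x rfl (v (pos x)))) = 0 := by
  let E (x : V) {i : ℕ} (hx : pos x = i) := M.positionEquiv hQ.injective x hx
  have conj_eq {x : V} {i : ℕ} (hx : pos x = i) (m : M.space x) :
      φ (pos x) ((E x rfl).symm m) • E x rfl (v (pos x)) =
        E x hx (φ i ((E x hx).symm m) • v i) := by
    subst hx
    exact (map_smul _ _ _).symm
  have apply_symm {x : V} {i : ℕ} (hx : pos x = i) (m : M.space x) :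
      (E x hx).symm m ⟨x, hx⟩ = m := (E x hx).apply_symm_apply m
  refine extMap_eq_iff.2 fun x y a m => sub_eq_zero.2 ?_
  change M.map a (φ (pos x) ((E x rfl).symm m) • E x rfl (v (pos x))) =
    φ (pos y) ((E y rfl).symm (M.map a m)) • E y rfl (v (pos y))
  rcases hQ.pos_eq a with ⟨hp, -⟩ | ⟨hp, -⟩
  · by_cases hzy : pos z < pos y
    · have := hz y hzy
      exact Subsingleton.elim _ _
    · have mem_iff {p} := mem_arrowRelation_of_left (M := M) (p := p) hQ rfl hp.symm a
      rw [conj_eq hp.symm]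
      refine mem_iff.1 (h.smul_mem_relation _ (by lia) _ _ (mem_iff.2 ?_))
      simp only [apply_symm]
  · by_cases hzx : pos z < pos x
    · have := hz x hzx
      simp [Subsingleton.elim m 0]
    · have mem_iff {p} := mem_arrowRelation_of_right (M := M) (p := p) hQ hp.symm rfl a
      rw [conj_eq hp.symm]
      refine mem_iff.1 (h.smul_mem_relation _ (by lia) _ _ (mem_iff.2 ?_))
      simp only [apply_symm]

theorem exists_rankOne_idempotent (hQ : IsLinear Q o pos) {n : ℕ} (hn : ∀ x, pos x < n)
    {M : QuiverRep k Q} (hM : ¬ M.IsZero) :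
    ∃ r s, r ≤ s ∧ s < n ∧ (∀ i, r ≤ i → i ≤ s → i ∈ Set.range pos) ∧
      ∃ (v : ∀ x, M.space x) (φ : ∀ x, Module.Dual k (M.space x)),
        (∀ x, r ≤ pos x → pos x ≤ s → φ x (v x) = 1) ∧
        (∀ x, ¬ (r ≤ pos x ∧ pos x ≤ s) → v x = 0) ∧
        extMap M M (fun x => (φ x).smulRight (v x)) = 0 := by
  obtain ⟨z, hz, hmax⟩ := exists_position_maximal hM hn
  have (i : ℕ) : Finite {x // pos x = i} :=
    have : Subsingleton {x // pos x = i} :=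
      ⟨fun x y => Subtype.ext (hQ.injective (x.2.trans y.2.symm))⟩
    Finite.of_subsingleton
  let E (x : V) := M.positionEquiv hQ.injective x rfl
  have := (E z).toEquiv.nontrivial
  obtain ⟨r, hrs, v, φ, h⟩ := exists_isAdaptedSequence (pos z) (M.arrowRelation pos)
    (C := ∅) Set.subsingleton_empty.isChain
  refine ⟨r, pos z, hrs, hn z, fun i hi his => ?_, fun x => E x (v (pos x)),
    fun x => φ (pos x) ∘ₗ (E x).symm, fun x hx hxs => ?_, fun x hx => ?_,
    extMap_smulRight_positionEquiv_eq_zero hQ hmax h⟩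
  · by_contra hi'
    have : IsEmpty {x // pos x = i} := ⟨fun x => hi' ⟨x, x.2⟩⟩
    exact one_ne_zero ((h.apply_self i hi his).symm.trans
      (by rw [Subsingleton.elim (v i) 0, map_zero]))
  · simpa using h.apply_self _ hx hxs
  · simp only [(h.eq_zero _ hx).1, map_zero]

theorem Indecomposable.exists_interval (hQ : IsLinear Q o pos) {n : ℕ} (hn : ∀ x, pos x < n)
    {M : QuiverRep k Q} (hM : M.Indecomposable) :
    ∃ r s, r ≤ s ∧ s < n ∧ (∀ i, r ≤ i → i ≤ s → i ∈ Set.range pos) ∧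
      ∀ x, M.dimVec x = if r ≤ pos x ∧ pos x ≤ s then 1 else 0 := by
  obtain ⟨r, s, hrs, hsn, hrange, v, φ, hφv, hv, hcomm⟩ := exists_rankOne_idempotent hQ hn hM.1
  have v_ne_zero {x : V} (hx : r ≤ pos x ∧ pos x ≤ s) : v x ≠ 0 := fun h =>
    one_ne_zero ((hφv x hx.1 hx.2).symm.trans (by rw [h, map_zero]))
  have idem (x : V) : IsIdempotentElem ((φ x).smulRight (v x)) := by
    by_cases hx : r ≤ pos x ∧ pos x ≤ s
    · exact LinearMap.ext fun m => by simp [hφv x hx.1 hx.2]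
    · exact LinearMap.ext fun m => by simp [hv x hx]
  have eq_id := (hM.eq_zero_or_eq_id idem hcomm).resolve_left fun h => by
    obtain ⟨x, rfl⟩ := hrange r le_rfl hrs
    have := LinearMap.congr_fun (h x) (v x)
    rw [LinearMap.smulRight_apply, hφv x le_rfl hrs, one_smul] at this
    exact v_ne_zero ⟨le_rfl, hrs⟩ this
  refine ⟨r, s, hrs, hsn, hrange, fun x => ?_⟩
  have smul_eq (m : M.space x) : φ x m • v x = m := LinearMap.congr_fun (eq_id x) m
  rw [dimVec]
  split_ifs with hx
  · rw [finrank_eq_one (v x) (v_ne_zero hx) fun m => ⟨φ x m, smul_eq m⟩, Nat.cast_one]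
  · have : Subsingleton (M.space x) :=
      subsingleton_of_forall_eq 0 fun m => by rw [← smul_eq m, hv x hx, smul_zero]
    rw [Module.finrank_zero_of_subsingleton, Nat.cast_zero]

end Indecomposable

end QuiverRep

section TiltingSet

open scoped NNReal

theorem exists_split_of_le_sum {ι : Type*} {ρ : ι → ℤ} (hρ : Function.Injective ρ) {w : ι → ℝ≥0}
    {O : Finset ι} (hO : O.Nonempty) {D : ℝ≥0} (hD : D ≤ ∑ a ∈ O, w a) :
    ∃ c ∈ O, ∃ t ≤ w c, D = ∑ a ∈ O with ρ a < ρ c, w a + t := by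
  classical
  induction O using Finset.induction_on_max_value ρ with
  | empty => simp at hO
  | insert c s hc hmax ih =>
    by_cases h : s.Nonempty ∧ D ≤ ∑ a ∈ s, w a
    · obtain ⟨b, hb, hD⟩ := ih h.1 h.2
      refine ⟨b, Finset.mem_insert_of_mem hb, ?_⟩
      rwa [Finset.filter_insert, if_neg (hmax b hb).not_gt]
    · refine ⟨c, Finset.mem_insert_self _ _, ?_⟩
      rw [Finset.filter_insert, if_neg (lt_irrefl _), Finset.filter_true_of_mem fun a ha =>
        lt_of_le_of_ne (hmax a ha) fun h => hc (hρ h ▸ ha)]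
      have hsD : ∑ a ∈ s, w a ≤ D := by
        rcases s.eq_empty_or_nonempty with rfl | hs
        · simp
        · exact (not_le.1 fun hD => h ⟨hs, hD⟩).le
      obtain ⟨t, rfl⟩ := exists_add_of_le hsD
      rw [Finset.sum_insert hc, add_comm] at hD
      exact ⟨t, le_of_add_le_add_right hD, rfl⟩

/-- The rank of the left end `a` of an interval. Between intervals with left ends `a` and `a'`, it
decides whether homomorphisms and extensions are obstructed at the left or at the right ends. -/
def leftRank (o : ℕ → Bool) (a : ℕ) : ℤ := if o (a - 1) then a else -a

/-- The rank of the left end `a` in the linear order on the intervals with right end `b` in which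
`[a, b]` precedes `[a', b]` if it is the better candidate for an extension to the right: then
`[a, b]` can be replaced by `[a, b + 1]` while `[a', b]` is kept. -/
def endRank (o : ℕ → Bool) (b a : ℕ) : ℤ := if o b then leftRank o a else -leftRank o a

theorem endRank_injective (o : ℕ → Bool) (b : ℕ) : Function.Injective (endRank o b) := by
  intro a a' h
  unfold endRank leftRank at h
  split_ifs at h <;> lia

theorem endRank_le_endRank_self (o : ℕ → Bool) {a j : ℕ} (h : a ≤ j) :
    endRank o (j - 1) a ≤ endRank o (j - 1) j := by
  unfold endRank leftRank
  split_ifs <;> lia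

/-- A set of pairwise compatible intervals `[b.1, b.2]` in `A` which cover `A` and are as many as
the elements of `A`: the supports of the summands of a tilting module over a quiver of type `A`
that is oriented by `o`. -/
structure IsTiltingSet (o : ℕ → Bool) (A : Finset ℕ) (C : Finset (ℕ × ℕ)) : Prop where
  interval : ∀ b ∈ C, b.1 ≤ b.2 ∧ ∀ i, b.1 ≤ i → i ≤ b.2 → i ∈ A
  compat : ∀ b ∈ C, ∀ c ∈ C, b.2 < c.2 → c.1 ≤ b.2 + 1 → endRank o b.2 c.1 ≤ endRank o b.2 b.1
  cover : ∀ i ∈ A, ∃ b ∈ C, b.1 ≤ i ∧ i ≤ b.2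
  card : C.card = A.card

variable {o : ℕ → Bool} {A : Finset ℕ} {C : Finset (ℕ × ℕ)} {j : ℕ}

theorem IsTiltingSet.right_mem (h : IsTiltingSet o A C) {b : ℕ × ℕ} (hb : b ∈ C) : b.2 ∈ A :=
  (h.interval b hb).2 b.2 (h.interval b hb).1 le_rfl

/-- The intervals ending at `j - 1` whose left ends are in `S` are extended to `j`, and so is the
interval from `c` to `j - 1`, without being removed (it is empty if `c = j`). -/
def extendTo (C : Finset (ℕ × ℕ)) (j : ℕ) (S : Finset ℕ) (c : ℕ) : Finset (ℕ × ℕ) :=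
  C \ S.image (fun a => (a, j - 1)) ∪ (insert c S).image fun a => (a, j)

theorem mem_extendTo {S : Finset ℕ} {c : ℕ} {b : ℕ × ℕ} :
    b ∈ extendTo C j S c ↔
      (b ∈ C ∧ (b.2 = j - 1 → b.1 ∉ S)) ∨ (b.1 ∈ insert c S ∧ b.2 = j) := by
  unfold extendTo
  grind

theorem card_extendTo {S : Finset ℕ} {c : ℕ} (hC : ∀ b ∈ C, b.2 < j)
    (hS : ∀ a ∈ S, (a, j - 1) ∈ C) (hc : c ∉ S) : (extendTo C j S c).card = C.card + 1 := by
  have hsub : S.image (fun a => (a, j - 1)) ⊆ C := by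
    simpa [Finset.image_subset_iff] using hS
  have hdisj : Disjoint (C \ S.image fun a => (a, j - 1)) ((insert c S).image fun a => (a, j)) := by
    refine Finset.disjoint_left.2 fun b hb hb' => ?_
    obtain ⟨a, -, rfl⟩ := Finset.mem_image.1 hb'
    exact (hC _ (Finset.mem_sdiff.1 hb).1).ne rfl
  have hcard := Finset.card_le_card hsub
  have hinj (i : ℕ) : Function.Injective fun a : ℕ => (a, i) := fun _ _ => congrArg Prod.fst
  rw [Finset.card_image_of_injective _ (hinj _)] at hcard
  rw [extendTo, Finset.card_union_of_disjoint hdisj, Finset.card_sdiff_of_subset hsub,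
    Finset.card_image_of_injective _ (hinj _), Finset.card_image_of_injective _ (hinj _),
    Finset.card_insert_of_notMem hc]
  lia

theorem IsTiltingSet.insert_extendTo (h : IsTiltingSet o A C) (hj : ∀ i ∈ A, i < j)
    {S : Finset ℕ} {c : ℕ}
    (hS : ∀ a ∈ S, (a, j - 1) ∈ C ∧ endRank o (j - 1) a < endRank o (j - 1) c)
    (hc : c = j ∨ (c, j - 1) ∈ C)
    (hSc : ∀ a, (a, j - 1) ∈ C → a ∉ S → endRank o (j - 1) c ≤ endRank o (j - 1) a) :
    IsTiltingSet o (insert j A) (extendTo C j S c) := by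
  have hlt {b} (hb : b ∈ C) : b.2 < j := hj _ (h.right_mem hb)
  have hstart {a} (ha : a ∈ insert c S) : a = j ∨ (a, j - 1) ∈ C := by grind
  have hrank {a} (ha : a ∈ insert c S) : endRank o (j - 1) a ≤ endRank o (j - 1) c := by grind
  refine ⟨fun b hb => ?_, fun b hb b' hb' hbb' hle => ?_, fun i hi => ?_, ?_⟩
  · rcases mem_extendTo.1 hb with ⟨hb, -⟩ | ⟨hb, hbj⟩
    · exact ⟨(h.interval b hb).1, fun i hi hi' =>
        Finset.mem_insert_of_mem ((h.interval b hb).2 i hi hi')⟩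
    · rcases hstart hb with hb | hb
      · grind
      · have := h.interval _ hb
        grind
  · replace hb : b ∈ C ∧ (b.2 = j - 1 → b.1 ∉ S) := by
      rw [mem_extendTo] at hb hb'
      grind
    rcases mem_extendTo.1 hb' with ⟨hb', -⟩ | ⟨hb', hbj⟩
    · exact h.compat b hb.1 b' hb' hbb' hle
    · by_cases hbj' : b.2 = j - 1
      · rw [hbj']
        exact (hrank hb').trans (hSc b.1 (hbj' ▸ hb.1) (hb.2 hbj'))
      · have := hlt hb.1
        exact h.compat b hb.1 (b'.1, j - 1) ((hstart hb').resolve_left (by lia)) (by grind) hle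
  · have hcj : c ≤ j := by
      rcases hc with rfl | hc
      · exact le_rfl
      · exact (h.interval _ hc).1.trans (Nat.sub_le j 1)
    rcases Finset.mem_insert.1 hi with rfl | hi
    · exact ⟨(c, i), mem_extendTo.2 (by grind), hcj, le_rfl⟩
    · obtain ⟨b, hb, hbi⟩ := h.cover i hi
      by_cases hbS : b.2 = j - 1 ∧ b.1 ∈ S
      · exact ⟨(b.1, j), mem_extendTo.2 (by grind), hbi.1, (hj i hi).le⟩
      · exact ⟨b, mem_extendTo.2 (by grind), hbi⟩
  · rw [card_extendTo (fun b hb => hlt hb) (fun a ha => (hS a ha).1) fun hc => (hS c hc).2.false,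
      h.card, Finset.card_insert_of_notMem fun h => (hj j h).false]

/-- The indicator function of the interval `[b.1, b.2]`. -/
noncomputable def intervalVec (b : ℕ × ℕ) : ℕ → ℝ≥0 := Set.indicator (Set.Icc b.1 b.2) 1

theorem intervalVec_apply (b : ℕ × ℕ) (i : ℕ) :
    intervalVec b i = if b.1 ≤ i ∧ i ≤ b.2 then 1 else 0 := by
  simp [intervalVec, Set.indicator_apply]

theorem intervalVec_self (j : ℕ) : intervalVec (j, j) = Pi.single j 1 := by
  funext i
  rw [intervalVec_apply, Pi.single_apply]
  grind

theorem intervalVec_extend {a j : ℕ} (h : a < j) :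
    intervalVec (a, j) = intervalVec (a, j - 1) + Pi.single j 1 := by
  funext i
  rw [Pi.add_apply, intervalVec_apply, intervalVec_apply, Pi.single_apply]
  grind

theorem IsTiltingSet.add_mem_span_extendTo (h : IsTiltingSet o A C) (hj : ∀ i ∈ A, i < j)
    {S : Finset ℕ} {c : ℕ} (hS : ∀ a ∈ S, (a, j - 1) ∈ C) (hcS : c ∉ S)
    (hc : c = j ∨ (c, j - 1) ∈ C) {w : ℕ × ℕ → ℝ≥0} {t : ℝ≥0} (ht : c ≠ j → t ≤ w (c, j - 1)) :
    ∑ b ∈ C, w b • intervalVec b + (∑ a ∈ S, w (a, j - 1) + t) • Pi.single j 1 ∈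
      Submodule.span ℝ≥0 (intervalVec '' (extendTo C j S c : Set (ℕ × ℕ))) := by
  have mem {b} (r : ℝ≥0) (hb : b ∈ extendTo C j S c) :
      r • intervalVec b ∈ Submodule.span ℝ≥0 (intervalVec '' (extendTo C j S c : Set (ℕ × ℕ))) :=
    Submodule.smul_mem _ r (Submodule.subset_span (Set.mem_image_of_mem _ hb))
  have hlt {a} (ha : (a, j - 1) ∈ C) : a < j :=
    (h.interval _ ha).1.trans_lt (hj _ (h.right_mem ha))
  have hsub : S.image (fun a => (a, j - 1)) ⊆ C := by
    simpa [Finset.image_subset_iff] using hS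
  have hextend : ∑ a ∈ S, w (a, j - 1) • intervalVec (a, j) =
      ∑ b ∈ S.image (fun a => (a, j - 1)), w b • intervalVec b +
        (∑ a ∈ S, w (a, j - 1)) • Pi.single j 1 := by
    rw [Finset.sum_image fun a _ a' _ => congrArg Prod.fst, Finset.sum_smul,
      ← Finset.sum_add_distrib]
    exact Finset.sum_congr rfl fun a ha => by rw [intervalVec_extend (hlt (hS a ha)), smul_add]
  have hkeep : ∑ b ∈ C \ S.image (fun a => (a, j - 1)), w b • intervalVec b +
      t • Pi.single j 1 ∈
        Submodule.span ℝ≥0 (intervalVec '' (extendTo C j S c : Set (ℕ × ℕ))) := by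
    rcases eq_or_ne c j with rfl | hcj
    · rw [← intervalVec_self]
      exact add_mem (sum_mem fun b hb => mem _ (mem_extendTo.2 (by grind)))
        (mem _ (mem_extendTo.2 (by grind)))
    · have hcC := hc.resolve_left hcj
      have hcw : w (c, j - 1) • intervalVec (c, j - 1) + t • Pi.single j 1 =
          (w (c, j - 1) - t) • intervalVec (c, j - 1) + t • intervalVec (c, j) := by
        rw [intervalVec_extend (hlt hcC), smul_add, ← add_assoc, ← add_smul,
          tsub_add_cancel_of_le (ht hcj)]
      rw [← Finset.sum_erase_add _ _ (a := (c, j - 1)) (by grind), add_assoc, hcw]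
      exact add_mem (sum_mem fun b hb => mem _ (mem_extendTo.2 (by grind)))
        (add_mem (mem _ (mem_extendTo.2 (by grind))) (mem _ (mem_extendTo.2 (by grind))))
  have hsum := add_mem hkeep (sum_mem fun a ha => mem (b := (a, j)) (w (a, j - 1))
    (mem_extendTo.2 (Or.inr ⟨Finset.mem_insert_of_mem ha, rfl⟩)))
  rw [hextend] at hsum
  rw [← Finset.sum_sdiff hsub, add_smul]
  convert hsum using 1
  abel

theorem exists_isTiltingSet (o : ℕ → Bool) (A : Finset ℕ) (d : ℕ → ℝ≥0)
    (hd : ∀ i ∉ A, d i = 0) :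
    ∃ C, IsTiltingSet o A C ∧
      d ∈ Submodule.span ℝ≥0 (intervalVec '' (C : Set (ℕ × ℕ))) := by
  induction A using Finset.induction_on_max generalizing d with
  | empty =>
    have hd : d = 0 := funext fun i => hd i (Finset.notMem_empty i)
    exact ⟨∅, ⟨by simp, by simp, by simp, rfl⟩, hd ▸ zero_mem _⟩
  | insert j A hj ih =>
    obtain ⟨C, hC, hdC⟩ := ih (Function.update d j 0) fun i hi => by
      rcases eq_or_ne i j with rfl | hij
      · simp
      · rw [Function.update_of_ne hij]
        exact hd i (by simp [hij, hi])
    obtain ⟨w, hw⟩ := (Submodule.mem_span_image_finset_iff_exists_fun' ℝ≥0).1 hdC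
    let E : Finset ℕ := {b ∈ C | b.2 = j - 1}.image Prod.fst
    have mem_E {a} : a ∈ E ↔ (a, j - 1) ∈ C := by simp [E]
    have hEj {a} (ha : a ∈ E) : a < j := by
      have h := mem_E.1 ha
      exact (hC.interval _ h).1.trans_lt (hj _ (hC.right_mem h))
    -- The value `d j` is used up by extending the intervals that end at `j - 1`, in the order of
    -- `endRank`; the weight of the last of them, `[c, j - 1]`, is split.
    obtain ⟨c, hc, t, ht, hdj⟩ := exists_split_of_le_sum (endRank_injective o (j - 1))
      (w := fun a => if a = j then d j else w (a, j - 1)) (O := insert j E) (D := d j)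
      (Finset.insert_nonempty j E) (by
        rw [Finset.sum_insert fun h => (hEj h).false, if_pos rfl]
        exact le_self_add)
    refine ⟨extendTo C j {a ∈ E | endRank o (j - 1) a < endRank o (j - 1) c} c,
      hC.insert_extendTo hj ?_ ?_ ?_, ?_⟩
    · grind
    · grind
    · grind
    · have hρj := endRank_le_endRank_self o (a := c) (j := j) (by grind)
      rw [Finset.filter_insert, if_neg hρj.not_gt, Finset.sum_congr rfl fun a ha =>
        if_neg (hEj (Finset.mem_filter.1 ha).1).ne] at hdj
      have hd : d = Function.update d j 0 + d j • Pi.single j 1 := by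
        funext i
        rcases eq_or_ne i j with rfl | hij <;> simp [*]
      rw [hd, ← hw, hdj]
      refine hC.add_mem_span_extendTo hj ?_ ?_ ?_ ?_
      · grind
      · grind
      · grind
      · intro hc
        simpa [hc] using ht

end TiltingSet

section Forest

/-- The underlying graph of the quiver is a rooted forest in which `parent x y` says that `x` is the
parent of `y`. -/
structure IsRootedForest {V : Type v} (Q : Quiver.{w} V) (parent : V → V → Prop) : Prop where
  wellFounded : WellFounded parent
  left_unique : ∀ x x' y, parent x y → parent x' y → x = x'
  subsingleton : ∀ x y, Subsingleton (Q.Hom x y)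
  isEmpty_symm : ∀ x y, Q.Hom x y → IsEmpty (Q.Hom y x)
  parent_or_parent : ∀ x y, Q.Hom x y → parent x y ∨ parent y x

theorem exists_forall_of_wellFounded {V α : Type*} [Nonempty α] {r : V → V → Prop}
    (hr : WellFounded r) {E : V → V → α → α → Prop}
    (h : ∀ y (s : V → α), ∃ t, ∀ x, r x y → E x y (s x) t) :
    ∃ s : V → α, ∀ x y, r x y → E x y (s x) (s y) := by
  classical
  choose f hf using h
  refine ⟨hr.fix fun y s => f y fun x => if h : r x y then s x h else Classical.arbitrary α,
    fun x y hxy => ?_⟩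
  have h := hf y (fun x => if r x y then hr.fix (fun y s => f y fun x =>
    if h : r x y then s x h else Classical.arbitrary α) x else Classical.arbitrary α) x hxy
  rw [if_pos hxy] at h
  rwa [hr.fix_eq _ y]

variable {V : Type v} {Q : Quiver.{w} V} {parent : V → V → Prop} {k : Type u} [Field k]

open Classical in
theorem IsRootedForest.exists_forall_sub_eq (hQ : IsRootedForest Q parent) {P R : V → Prop}
    (hP : ∀ x y, Q.Hom x y → parent x y → P x → R y → P y)
    (hR : ∀ x y, Q.Hom y x → parent x y → P y → R x → R y) (c : ∀ x y, Q.Hom x y → k) :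
    ∃ s : V → k, ∀ x y (a : Q.Hom x y), P x → R y →
      (if R x then 1 else 0) * s x - (if P y then 1 else 0) * s y = c x y a := by
  let E (x y : V) (s t : k) : Prop :=
    (∀ a : Q.Hom x y, P x → R y →
      (if R x then 1 else 0) * s - (if P y then 1 else 0) * t = c x y a) ∧
    ∀ a : Q.Hom y x, P y → R x →
      (if R y then 1 else 0) * t - (if P x then 1 else 0) * s = c y x a
  suffices h : ∀ y (s : V → k), ∃ t, ∀ x, parent x y → E x y (s x) t by
    obtain ⟨s, hs⟩ := exists_forall_of_wellFounded hQ.wellFounded h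
    exact ⟨s, fun x y a => (hQ.parent_or_parent x y a).elim (fun h => (hs x y h).1 a)
      fun h => (hs y x h).2 a⟩
  intro y s
  by_cases h : ∃ x, parent x y ∧
      (Nonempty (Q.Hom x y) ∧ P x ∧ R y ∨ Nonempty (Q.Hom y x) ∧ P y ∧ R x)
  · obtain ⟨x, hxy, ⟨⟨a⟩, hPx, hRy⟩ | ⟨⟨a⟩, hPy, hRx⟩⟩ := h
    · refine ⟨(if R x then 1 else 0) * s x - c x y a, fun x' hx' => ?_⟩
      obtain rfl := hQ.left_unique x x' y hxy hx'
      refine ⟨fun a' _ _ => ?_, fun a' => ((hQ.isEmpty_symm x y a).false a').elim⟩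
      rw [if_pos (hP x y a hxy hPx hRy), (hQ.subsingleton x y).elim a' a]
      ring
    · refine ⟨(if P x then 1 else 0) * s x + c y x a, fun x' hx' => ?_⟩
      obtain rfl := hQ.left_unique x x' y hxy hx'
      refine ⟨fun a' => ((hQ.isEmpty_symm y x a).false a').elim, fun a' _ _ => ?_⟩
      rw [if_pos (hR x y a hxy hPy hRx), (hQ.subsingleton y x).elim a' a]
      ring
  · exact ⟨0, fun x hxy => ⟨fun a hPx hRy => (h ⟨x, hxy, .inl ⟨⟨a⟩, hPx, hRy⟩⟩).elim,
      fun a hPy hRx => (h ⟨x, hxy, .inr ⟨⟨a⟩, hPy, hRx⟩⟩).elim⟩⟩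

end Forest

section ThinHom

variable {k : Type u} [Field k] (p q r : Prop)

open Classical in
/-- The canonical map between two spaces which are one-dimensional or zero according to whether
`p` and `q` hold: it is the identity if both do. -/
noncomputable def thinHom : (PLift p → k) →ₗ[k] (PLift q → k) :=
  LinearMap.pi fun _ => if h : p then LinearMap.proj ⟨h⟩ else 0

variable {p q r}

theorem thinHom_apply (hp : p) (m : PLift p → k) (j : PLift q) : thinHom p q m j = m ⟨hp⟩ := by
  simp [thinHom, hp]

theorem eq_smul_thinHom (g : (PLift p → k) →ₗ[k] (PLift q → k)) :
    ∃ c : k, g = c • thinHom p q := by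
  by_cases hpq : p ∧ q
  · refine ⟨g 1 ⟨hpq.2⟩, LinearMap.ext fun m => funext fun j => ?_⟩
    have hm : m = m ⟨hpq.1⟩ • 1 := by
      funext i
      simp
    rw [LinearMap.smul_apply, Pi.smul_apply, thinHom_apply hpq.1, smul_eq_mul, mul_comm]
    conv_lhs => rw [hm, map_smul, Pi.smul_apply, smul_eq_mul]
  · refine ⟨0, LinearMap.ext fun m => funext fun j => ?_⟩
    have hm : m = 0 := funext fun i => (hpq ⟨i.down, j.down⟩).elim
    rw [hm, map_zero, map_zero]

open Classical in
theorem thinHom_thinHom (m : PLift p → k) :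
    thinHom q r (thinHom p q m) = (if q then (1 : k) else 0) • thinHom p r m := by
  funext j
  by_cases hp : p
  · by_cases hq : q
    · rw [thinHom_apply hq, thinHom_apply hp, if_pos hq, one_smul, thinHom_apply hp]
    · simp [thinHom, hq]
  · have hm : m = 0 := funext fun j => (hp j.down).elim
    simp [hm]

theorem thinHom_injective (hq : q) : Function.Injective (thinHom (k := k) p q) := by
  intro m m' h
  funext j
  simpa [thinHom_apply j.down] using congrFun h ⟨hq⟩

theorem thinHom_eq_zero (h : ¬ (p ∧ q)) : thinHom (k := k) p q = 0 := by
  ext m j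
  by_cases hp : p
  · exact (h ⟨hp, j.down⟩).elim
  · simp [thinHom, hp]

end ThinHom

section Interval

variable {V : Type v} {Q : Quiver.{w} V} {o : ℕ → Bool} {pos : V → ℕ}

theorem IsLinear.eq_of_forall_arrow (hQ : IsLinear Q o pos) {r s : ℕ}
    (hmem : ∀ i, r ≤ i → i ≤ s → i ∈ Set.range pos) {β : Type*} {f : V → β}
    (hf : ∀ x y, Nonempty (Q.Hom x y) → pos x ∈ Set.Icc r s → pos y ∈ Set.Icc r s → f x = f y)
    {x y : V} (hx : pos x = r) (hy : pos y ∈ Set.Icc r s) : f y = f x := by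
  obtain ⟨hi, his⟩ := hy
  generalize hi' : pos y = i at hi his
  induction i, hi using Nat.le_induction generalizing y with
  | base => rw [hQ.injective (hx.trans hi'.symm)]
  | succ i hi ih =>
    obtain ⟨z, rfl⟩ := hmem i hi (by lia)
    rw [← ih rfl (by lia)]
    have hz : pos z ∈ Set.Icc r s := ⟨hi, by lia⟩
    have hy : pos y ∈ Set.Icc r s := ⟨by lia, by lia⟩
    cases ho : o (pos z)
    · exact hf y z ((hQ.nonempty_iff y z).2 (Or.inr ⟨hi'.symm, ho⟩)) hy hz
    · exact (hf z y ((hQ.nonempty_iff z y).2 (Or.inl ⟨hi'.symm, ho⟩)) hz hy).symm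

theorem IsLinear.isRootedForest_left (hQ : IsLinear Q o pos) :
    IsRootedForest Q fun x y => pos x + 1 = pos y where
  wellFounded := (measure pos).wf.mono fun x y (h : pos x + 1 = pos y) => Nat.lt_of_succ_le h.le
  left_unique x x' y h h' := hQ.injective (by lia)
  subsingleton := hQ.subsingleton
  isEmpty_symm x y a := ⟨fun b => by grind [hQ.pos_eq a, hQ.pos_eq b]⟩
  parent_or_parent x y a := (hQ.pos_eq a).imp And.left And.left

theorem IsLinear.isRootedForest_right [Finite V] (hQ : IsLinear Q o pos) :
    IsRootedForest Q fun x y => pos y + 1 = pos x where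
  wellFounded := by
    let _ : Preorder V := Preorder.lift pos
    exact (wellFounded_gt (α := V)).mono fun x y (h : pos y + 1 = pos x) => Nat.lt_of_succ_le h.le
  left_unique x x' y h h' := hQ.injective (by lia)
  subsingleton := hQ.subsingleton
  isEmpty_symm := hQ.isRootedForest_left.isEmpty_symm
  parent_or_parent x y a := (hQ.isRootedForest_left.parent_or_parent x y a).symm

end Interval

namespace QuiverRep

section Thin

variable {k : Type u} [Field k] {V : Type v} {Q : Quiver.{w} V} {o : ℕ → Bool} {pos : V → ℕ}
  {M N : QuiverRep k Q}

theorem Isomorphic.dimVec_eq (h : M.Isomorphic N) : M.dimVec = N.dimVec := by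
  obtain ⟨e, -⟩ := h
  funext x
  rw [dimVec, dimVec, (e x).finrank_eq]

theorem Isomorphic.map_injective (h : M.Isomorphic N) {x y : V} {a : Q.Hom x y}
    (ha : Function.Injective (M.map a)) : Function.Injective (N.map a) := by
  obtain ⟨e, he⟩ := h
  intro m m' hm
  obtain ⟨n, rfl⟩ := (e x).surjective m
  obtain ⟨n', rfl⟩ := (e x).surjective m'
  rw [← he, ← he] at hm
  exact congrArg (e x) (ha ((e y).injective hm))

theorem dimVec_prod (M N : QuiverRep k Q) : (M.prod N).dimVec = M.dimVec + N.dimVec := by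
  funext x
  exact (congrArg Nat.cast Module.finrank_prod).trans (Nat.cast_add _ _)

theorem dimVec_le_of_injective {x y : V} {a : Q.Hom x y} (ha : Function.Injective (M.map a)) :
    M.dimVec x ≤ M.dimVec y :=
  Nat.cast_le.2 (LinearMap.finrank_le_finrank_of_injective ha)

theorem dimVec_eq_zero_or_eq_zero_of_add_eq_one {x : V} (h : M.dimVec x + N.dimVec x = 1) :
    M.dimVec x = 0 ∨ N.dimVec x = 0 := by
  simp only [dimVec] at h ⊢
  norm_cast at h ⊢
  lia

theorem isZero_iff : M.IsZero ↔ M.dimVec = 0 := by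
  simp only [IsZero, funext_iff, dimVec, Pi.zero_apply, Nat.cast_eq_zero, Module.finrank_zero_iff]

/-- The thin representation with support `P`: it has one-dimensional spaces at the vertices in `P`,
with identities between them, and is zero elsewhere. -/
noncomputable def thin (k : Type u) [Field k] {V : Type v} (Q : Quiver.{w} V) (P : V → Prop) :
    QuiverRep k Q where
  space x := PLift (P x) → k
  map {x y} _ := thinHom (P x) (P y)

open Classical in
theorem dimVec_thin (P : V → Prop) (x : V) : (thin k Q P).dimVec x = if P x then 1 else 0 := by
  refine (congrArg Nat.cast (Module.finrank_fintype_fun_eq_card k)).trans ?_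
  split_ifs with h <;> simp [h]

theorem nontrivial_thin_iff (P : V → Prop) (x : V) :
    Nontrivial ((thin k Q P).space x) ↔ P x := by
  classical
  rw [← Module.finrank_pos_iff (R := k), ← Nat.cast_pos (α := ℝ)]
  change 0 < (thin k Q P).dimVec x ↔ P x
  rw [dimVec_thin]
  split_ifs with h <;> simp [h]

/-- The thin representation supported on the vertices at the positions `b.1, …, b.2`. -/
noncomputable abbrev intervalRep (k : Type u) [Field k] {V : Type v} (Q : Quiver.{w} V)
    (pos : V → ℕ) (b : ℕ × ℕ) : QuiverRep k Q :=
  thin k Q fun x => pos x ∈ Set.Icc b.1 b.2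

theorem indecomposable_intervalRep (hQ : IsLinear Q o pos) {b : ℕ × ℕ} (hb : b.1 ≤ b.2)
    (hmem : ∀ i, b.1 ≤ i → i ≤ b.2 → i ∈ Set.range pos) :
    (intervalRep k Q pos b).Indecomposable := by
  classical
  obtain ⟨x₀, hx₀⟩ := hmem b.1 le_rfl hb
  have hx₀b : pos x₀ ∈ Set.Icc b.1 b.2 := ⟨hx₀.ge, hx₀.trans_le hb⟩
  refine ⟨fun h => ?_, fun A B hAB => ?_⟩
  · have h := congrFun (isZero_iff.1 h) x₀
    rw [dimVec_thin, if_pos hx₀b] at h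
    exact one_ne_zero h
  have hsum (x : V) : A.dimVec x + B.dimVec x = if pos x ∈ Set.Icc b.1 b.2 then 1 else 0 := by
    rw [← Pi.add_apply, ← dimVec_prod, ← hAB.dimVec_eq, dimVec_thin]
    congr
  have hle {x y : V} (a : Q.Hom x y) (hy : pos y ∈ Set.Icc b.1 b.2) :
      A.dimVec x ≤ A.dimVec y ∧ B.dimVec x ≤ B.dimVec y := by
    have h := Prod.map_injective.1 (hAB.map_injective (a := a) (thinHom_injective hy))
    exact ⟨dimVec_le_of_injective h.1, dimVec_le_of_injective h.2⟩
  have hconst {x : V} (hx : pos x ∈ Set.Icc b.1 b.2) : A.dimVec x = A.dimVec x₀ :=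
    hQ.eq_of_forall_arrow hmem (fun x y ⟨a⟩ hx hy => by
      have h := hle a hy
      have hxs := hsum x
      have hys := hsum y
      rw [if_pos hx] at hxs
      rw [if_pos hy] at hys
      linarith) hx₀ hx
  have hA (x : V) : 0 ≤ A.dimVec x := Nat.cast_nonneg _
  have hB (x : V) : 0 ≤ B.dimVec x := Nat.cast_nonneg _
  have hx₀sum := hsum x₀
  rw [if_pos hx₀b] at hx₀sum
  simp only [isZero_iff, funext_iff, Pi.zero_apply]
  refine (dimVec_eq_zero_or_eq_zero_of_add_eq_one hx₀sum).imp (fun h x => ?_) fun h x => ?_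
  all_goals
    have hx := hsum x
    split_ifs at hx with hxb
    · linarith [hconst hxb, hA x, hB x]
    · linarith [hA x, hB x]

open Classical in
theorem extMap_thin_surjective {P R : V → Prop}
    (h : ∀ c : ∀ x y, Q.Hom x y → k, ∃ s : V → k, ∀ x y (a : Q.Hom x y), P x → R y →
      (if R x then 1 else 0) * s x - (if P y then 1 else 0) * s y = c x y a) :
    Function.Surjective (extMap (thin k Q P) (thin k Q R)) := by
  intro φ
  choose c hc using fun x y a => eq_smul_thinHom (k := k) (p := P x) (q := R y) (φ x y a)
  obtain ⟨s, hs⟩ := h c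
  refine ⟨fun x => s x • thinHom (P x) (R x), extMap_eq_iff.2 fun x y a m => ?_⟩
  have key (m : PLift (P x) → k) : thinHom (R x) (R y) (s x • thinHom (P x) (R x) m) -
      s y • thinHom (P y) (R y) (thinHom (P x) (P y) m) = c x y a • thinHom (P x) (R y) m := by
    rw [map_smul, thinHom_thinHom, thinHom_thinHom, smul_smul, smul_smul, ← sub_smul, mul_comm,
      mul_comm (s y)]
    by_cases hPR : P x ∧ R y
    · rw [hs x y a hPR.1 hPR.2]
    · rw [thinHom_eq_zero hPR, LinearMap.zero_apply, smul_zero, smul_zero]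
  exact (key m).trans (LinearMap.congr_fun (hc x y a) m).symm

theorem extMap_intervalRep_surjective [Finite V] (hQ : IsLinear Q o pos) {b c : ℕ × ℕ}
    (hbc : b.2 < c.2 → c.1 ≤ b.2 + 1 → endRank o b.2 c.1 ≤ endRank o b.2 b.1)
    (hcb : c.2 < b.2 → b.1 ≤ c.2 + 1 → endRank o c.2 b.1 ≤ endRank o c.2 c.1) :
    Function.Surjective (extMap (intervalRep k Q pos b) (intervalRep k Q pos c)) := by
  refine extMap_thin_surjective ?_
  -- The root of the forest is placed at the end of the line where an obstruction is possible.
  rcases lt_or_ge (leftRank o b.1) (leftRank o c.1) with hlt | hle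
  · refine hQ.isRootedForest_left.exists_forall_sub_eq (fun x y a hxy hx hy => ?_)
      fun x y a hxy hy hx => ?_
    all_goals
      simp only [Set.mem_Icc] at hx hy ⊢
      have ho := hQ.pos_eq a
      by_contra hend
    · have : b.2 = pos x := by lia
      grind [endRank]
    · have : c.2 = pos x := by lia
      grind [endRank]
  · refine hQ.isRootedForest_right.exists_forall_sub_eq (fun x y a hxy hx hy => ?_)
      fun x y a hxy hy hx => ?_
    all_goals
      simp only [Set.mem_Icc] at hx hy ⊢
      have ho := hQ.pos_eq a
      by_contra hend
    · have hb : b.1 - 1 = pos y := by lia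
      simp only [leftRank, hb] at hle
      grind
    · have hc : c.1 - 1 = pos y := by lia
      simp only [leftRank, hc] at hle
      grind

theorem eq_of_isomorphic_intervalRep {A : Finset ℕ} (hA : (A : Set ℕ) = Set.range pos) {b c : ℕ × ℕ}
    (hb : b.1 ≤ b.2 ∧ ∀ i, b.1 ≤ i → i ≤ b.2 → i ∈ A)
    (hc : c.1 ≤ c.2 ∧ ∀ i, c.1 ≤ i → i ≤ c.2 → i ∈ A)
    (hbc : (intervalRep k Q pos b).Isomorphic (intervalRep k Q pos c)) : b = c := by
  classical
  have h {i : ℕ} (hi : i ∈ A) : i ∈ Set.Icc b.1 b.2 ↔ i ∈ Set.Icc c.1 c.2 := by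
    obtain ⟨x, rfl⟩ : i ∈ Set.range pos := hA ▸ Finset.mem_coe.2 hi
    have hx := congrFun hbc.dimVec_eq x
    rw [dimVec_thin, dimVec_thin] at hx
    split_ifs at hx with h h' h'
    · exact iff_of_true h h'
    · exact (one_ne_zero hx).elim
    · exact (zero_ne_one hx).elim
    · exact iff_of_false h h'
  have h1 := h (hb.2 _ le_rfl hb.1)
  have h2 := h (hb.2 _ hb.1 le_rfl)
  have h3 := h (hc.2 _ le_rfl hc.1)
  have h4 := h (hc.2 _ hc.1 le_rfl)
  simp only [Set.mem_Icc] at h1 h2 h3 h4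
  ext <;> lia

theorem isTilting_intervalRep [Finite V] (hQ : IsLinear Q o pos) {A : Finset ℕ}
    (hA : (A : Set ℕ) = Set.range pos) {C : Finset (ℕ × ℕ)} (hC : IsTiltingSet o A C) {m : ℕ}
    (e : Fin m ≃ C) : IsTilting fun i => intervalRep k Q pos (e i) where
  card_eq := by
    rw [← Nat.card_range_of_injective hQ.injective, ← hA, Nat.card_coe_set_eq,
      Set.ncard_coe_finset, ← hC.card, ← Fintype.card_coe, ← Fintype.card_congr e,
      Fintype.card_fin]
  indecomposable i := by
    obtain ⟨hle, hmem⟩ := hC.interval _ (e i).2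
    exact indecomposable_intervalRep hQ hle fun j hj hj' => hA ▸ Finset.mem_coe.2 (hmem j hj hj')
  pairwise_not_isomorphic i j hij h := hij <| e.injective <| Subtype.ext <|
    eq_of_isomorphic_intervalRep hA (hC.interval _ (e i).2) (hC.interval _ (e j).2) h
  rigid := subsingleton_ext1_directSum_iff.2 fun i j => extMap_intervalRep_surjective hQ
    (hC.compat _ (e i).2 _ (e j).2) (hC.compat _ (e j).2 _ (e i).2)

theorem isSupportTilting_of_restrict {m : ℕ} {T : Fin m → QuiverRep k Q} {S : Set V}
    (hS : supp T = S) (h : IsTilting fun i => (T i).restrict S) : IsSupportTilting T := by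
  subst hS
  exact h

end Thin

end QuiverRep

section DropSum

variable {V : Type*} [Fintype V] {pos : V → ℕ}

/-- The coordinate at the position following `pos x`, read as zero if no vertex has this position;
it is the sum of the at most one coordinate there when `pos` is injective. -/
noncomputable def nextEntry (pos : V → ℕ) (x : V) : (V → ℝ) →ₗ[ℝ] ℝ :=
  ∑ y with pos y = pos x + 1, LinearMap.proj y

/-- The sum of the downward jumps of `d` along the line. For a dimension vector `d` of a linear
quiver it is the number of indecomposable summands of a generic representation. -/
noncomputable def dropSum (pos : V → ℕ) (d : V → ℝ) : ℝ := ∑ x, (d x - nextEntry pos x d)⁺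

theorem nextEntry_apply (pos : V → ℕ) (x : V) (d : V → ℝ) :
    nextEntry pos x d = ∑ y with pos y = pos x + 1, d y := by
  simp [nextEntry]

theorem nextEntry_nonneg {d : V → ℝ} (hd : 0 ≤ d) (x : V) : 0 ≤ nextEntry pos x d := by
  rw [nextEntry_apply]
  exact Finset.sum_nonneg fun y _ => hd y

theorem nextEntry_eq (hpos : Function.Injective pos) {x y : V} (h : pos y = pos x + 1)
    (d : V → ℝ) : nextEntry pos x d = d y := by
  rw [nextEntry_apply, Finset.sum_filter, Fintype.sum_eq_single y, if_pos h]
  exact fun z hz => if_neg fun h' => hz (hpos (h'.trans h.symm))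

theorem nextEntry_eq_zero {x : V} {d : V → ℝ} (h : ∀ y, pos y = pos x + 1 → d y = 0) :
    nextEntry pos x d = 0 := by
  rw [nextEntry_apply]
  exact Finset.sum_eq_zero fun y hy => h y (Finset.mem_filter.1 hy).2

theorem dropSum_nonneg (pos : V → ℕ) (d : V → ℝ) : 0 ≤ dropSum pos d :=
  Finset.sum_nonneg fun _ _ => posPart_nonneg _

@[fun_prop]
theorem continuous_dropSum (pos : V → ℕ) : Continuous (dropSum pos) := by
  have h (x : V) : Continuous (nextEntry pos x) := LinearMap.continuous_of_finiteDimensional _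
  unfold dropSum
  simp only [posPart_def]
  fun_prop

theorem dropSum_sum_smul {ι : Type*} [Fintype ι] {c : ι → ℝ} (hc : 0 ≤ c) {d : ι → V → ℝ}
    (h : ∀ x, (∀ i, d i x ≤ nextEntry pos x (d i)) ∨ ∀ i, nextEntry pos x (d i) ≤ d i x) :
    dropSum pos (∑ i, c i • d i) = ∑ i, c i * dropSum pos (d i) := by
  simp only [dropSum, Finset.mul_sum]
  rw [Finset.sum_comm]
  refine Finset.sum_congr rfl fun x _ => ?_
  have hsum : (∑ i, c i • d i) x - nextEntry pos x (∑ i, c i • d i) =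
      ∑ i, c i * (d i x - nextEntry pos x (d i)) := by
    simp [mul_sub, Finset.sum_apply]
  rw [hsum]
  rcases h x with h | h
  · have h' i : d i x - nextEntry pos x (d i) ≤ 0 := sub_nonpos.2 (h i)
    rw [posPart_of_nonpos (Finset.sum_nonpos fun i _ =>
      mul_nonpos_of_nonneg_of_nonpos (hc i) (h' i))]
    simp [posPart_of_nonpos (h' _)]
  · have h' i : 0 ≤ d i x - nextEntry pos x (d i) := sub_nonneg.2 (h i)
    rw [posPart_of_nonneg (Finset.sum_nonneg fun i _ => mul_nonneg (hc i) (h' i))]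
    simp [posPart_of_nonneg (h' _)]

theorem dropSum_smul {t : ℝ} (ht : 0 ≤ t) (d : V → ℝ) :
    dropSum pos (t • d) = t * dropSum pos d := by
  simpa using dropSum_sum_smul (ι := Unit) (c := fun _ => t) (d := fun _ => d) (fun _ => ht)
    fun x => by simpa using le_total _ _

theorem dropSum_interval (hpos : Function.Injective pos) {r s : ℕ} (hrs : r ≤ s)
    (hmem : ∀ i, r ≤ i → i ≤ s → i ∈ Set.range pos) :
    dropSum pos (fun x => if r ≤ pos x ∧ pos x ≤ s then 1 else 0) = 1 := by
  obtain ⟨z, hz⟩ := hmem s hrs le_rfl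
  have hnext {x : V} (h : ¬ (r ≤ pos x + 1 ∧ pos x + 1 ≤ s)) :
      nextEntry pos x (fun x => if r ≤ pos x ∧ pos x ≤ s then 1 else 0) = 0 :=
    nextEntry_eq_zero fun y hy => if_neg (hy ▸ h)
  rw [dropSum, Fintype.sum_eq_single z]
  · rw [hnext (by lia), if_pos (by lia)]
    norm_num
  · intro x hx
    have hxs : pos x ≠ s := fun h => hx (hpos (h.trans hz.symm))
    by_cases h : r ≤ pos x + 1 ∧ pos x + 1 ≤ s
    · obtain ⟨y, hy⟩ := hmem _ h.1 h.2
      rw [nextEntry_eq hpos hy, if_pos (c := r ≤ pos y ∧ pos y ≤ s) (hy ▸ h)]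
      exact posPart_of_nonpos (by split_ifs <;> norm_num)
    · rw [hnext h, if_neg (by lia)]
      norm_num

theorem dropSum_comp {W : Type*} [Fintype W] {f : W → V} (hf : Function.Injective f) {d : V → ℝ}
    (hd : 0 ≤ d) (hf' : ∀ x ∉ Set.range f, d x = 0) :
    dropSum (pos ∘ f) (d ∘ f) = dropSum pos d := by
  refine Fintype.sum_of_injective f hf _ _ (fun x hx => ?_) fun x => ?_
  · exact posPart_of_nonpos (sub_nonpos.2 ((hf' x hx).trans_le (nextEntry_nonneg hd x)))
  · have hnext : nextEntry (pos ∘ f) x (d ∘ f) = nextEntry pos (f x) d := by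
      simp only [nextEntry_apply, Finset.sum_filter]
      exact Fintype.sum_of_injective f hf _ _ (fun y hy => by simp [hf' y hy]) fun y => rfl
    rw [hnext, Function.comp_apply]

theorem dropSum_add_right (c : ℕ) (d : V → ℝ) :
    dropSum (fun x => pos x + c) d = dropSum pos d := by
  simp only [dropSum, nextEntry_apply, Nat.add_right_comm _ c 1, Nat.add_right_cancel_iff]

theorem dropSum_sumElim {W : Type*} [Fintype W] {pos' : W → ℕ} (h : ∀ x y, pos x + 1 < pos' y)
    (d : V ⊕ W → ℝ) :
    dropSum (Sum.elim pos pos') d = dropSum pos (d ∘ Sum.inl) + dropSum pos' (d ∘ Sum.inr) := by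
  have h₁ (x : V) (y : W) : pos' y ≠ pos x + 1 := (h x y).ne'
  have h₂ (x : V) (y : W) : pos x ≠ pos' y + 1 := by have := h x y; lia
  simp only [dropSum, nextEntry_apply, Finset.sum_filter, Fintype.sum_sum_type, Sum.elim_inl,
    Sum.elim_inr, h₁, h₂, Function.comp_apply, if_false, Finset.sum_const_zero, add_zero, zero_add]
  rfl

end DropSum

section Simplex

theorem mem_convexHull_insert_zero_range {ι E : Type*} [Fintype ι] [AddCommGroup E] [Module ℝ E]
    {f : ι → E} {p : E} :
    p ∈ convexHull ℝ (insert 0 (Set.range f)) ↔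
      ∃ w : ι → ℝ, 0 ≤ w ∧ ∑ i, w i ≤ 1 ∧ p = ∑ i, w i • f i := by
  classical
  have hrange : insert 0 (Set.range f) =
      Fintype.linearCombination ℝ (fun i : Option ι => i.elim 0 f) ''
        Set.range fun i => Pi.single i 1 := by
    rw [← Set.range_comp, ← Option.range_elim]
    congr 1
    ext i
    simp [Fintype.linearCombination_apply_single]
  rw [hrange, ← LinearMap.image_convexHull, convexHull_rangle_single_eq_stdSimplex]
  constructor
  · rintro ⟨w, ⟨hw, hw'⟩, rfl⟩
    rw [Fintype.sum_option] at hw'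
    exact ⟨fun i => w (some i), fun i => hw _, by linarith [hw none],
      by simp [Fintype.linearCombination_apply, Fintype.sum_option]⟩
  · rintro ⟨w, hw, hw', rfl⟩
    refine ⟨fun i => i.elim (1 - ∑ i, w i) w, ⟨?_, by simp [Fintype.sum_option]⟩,
      by simp [Fintype.linearCombination_apply, Fintype.sum_option]⟩
    rintro (_ | i)
    exacts [sub_nonneg.2 hw', hw i]

variable {V : Type*}

theorem posPart_sub_eq_of_disjoint {a b : V → ℝ} (ha : 0 ≤ a) (hb : 0 ≤ b)
    (hab : ∀ x, a x = 0 ∨ b x = 0) : (a - b)⁺ = a ∧ (a - b)⁻ = b := by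
  constructor <;> ext x <;> rcases hab x with h | h
  exacts [by simpa [h] using hb x, by simpa [h] using ha x, by simpa [h] using hb x,
    by simpa [h] using ha x]

theorem mem_convexHull_insert_zero_union_neg {ι κ : Type*} [Fintype ι] [Fintype κ]
    {f : ι → V → ℝ} {g : κ → V → ℝ} (hf : 0 ≤ f) (hg : 0 ≤ g)
    (hfg : ∀ x, (∀ i, f i x = 0) ∨ ∀ j, g j x = 0) {p : V → ℝ} :
    p ∈ convexHull ℝ (insert 0 (Set.range f ∪ Set.range fun j => -g j)) ↔
      ∃ (c : ι → ℝ) (d : κ → ℝ), 0 ≤ c ∧ 0 ≤ d ∧ ∑ i, c i + ∑ j, d j ≤ 1 ∧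
        p⁺ = ∑ i, c i • f i ∧ p⁻ = ∑ j, d j • g j := by
  rw [← Set.Sum.elim_range, mem_convexHull_insert_zero_range]
  simp only [Fintype.sum_sum_type, Sum.elim_inl, Sum.elim_inr, smul_neg, Finset.sum_neg_distrib,
    ← sub_eq_add_neg]
  constructor
  · rintro ⟨w, hw, hw', rfl⟩
    refine ⟨_, _, fun i => hw (.inl i), fun j => hw (.inr j), hw', posPart_sub_eq_of_disjoint
      (Finset.sum_nonneg fun i _ => smul_nonneg (hw _) (hf i))
      (Finset.sum_nonneg fun j _ => smul_nonneg (hw _) (hg j)) fun x => ?_⟩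
    exact (hfg x).imp (fun h => by simp [h]) fun h => by simp [h]
  · rintro ⟨c, d, hc, hd, hcd, hpc, hpd⟩
    refine ⟨Sum.elim c d, Sum.rec hc hd, hcd, ?_⟩
    simp only [Sum.elim_inl, Sum.elim_inr]
    rw [← hpc, ← hpd, posPart_sub_negPart]

theorem sum_sum_smul_single_apply [Fintype V] [DecidableEq V] {ι : Type*} [Fintype ι] (c : ι → ℝ)
    (f : ι → V) : ∑ x, (∑ j, c j • (Pi.single (f j) 1 : V → ℝ)) x = ∑ j, c j := by
  simp only [Finset.sum_apply]
  rw [Finset.sum_comm]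
  simp [← Finset.mul_sum]

theorem sum_coe_smul_single [Finite V] [DecidableEq V] {S : Set V} [Fintype S] {d : V → ℝ}
    (hd : ∀ x ∉ S, d x = 0) : ∑ j : S, d j • (Pi.single (j : V) 1 : V → ℝ) = d := by
  cases nonempty_fintype V
  rw [Fintype.sum_of_injective ((↑) : S → V) Subtype.val_injective _
    (fun x => d x • (Pi.single x 1 : V → ℝ)) (fun x hx => ?_) fun _ => rfl]
  · simp [← Pi.single_smul, Finset.univ_sum_single]
  · rw [Subtype.range_coe] at hx
    rw [hd x hx, zero_smul]

end Simplex

namespace QuiverRep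

section Polytopes

variable {k : Type u} [Field k] {V : Type v} {Q : Quiver.{w} V} {o : ℕ → Bool} {pos : V → ℕ}
  {m : ℕ} {T : Fin m → QuiverRep k Q}

theorem dimVec_nonneg (M : QuiverRep k Q) : 0 ≤ M.dimVec := fun _ => Nat.cast_nonneg _

theorem dimVec_le_or_le_of_rigid (hT : Subsingleton (Ext1 (directSum T) (directSum T))) {x y : V}
    (a : Q.Hom x y) :
    (∀ i, (T i).dimVec x ≤ (T i).dimVec y) ∨ ∀ i, (T i).dimVec y ≤ (T i).dimVec x := by
  rw [subsingleton_ext1_directSum_iff] at hT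
  refine or_iff_not_imp_left.2 fun h j => ?_
  obtain ⟨i, hi⟩ := not_forall.1 h
  have hsurj := (injective_or_surjective_of_extMap_surjective (hT i j) a).resolve_left
    fun h => hi (dimVec_le_of_injective h)
  exact Nat.cast_le.2 (LinearMap.finrank_le_finrank_of_surjective hsurj)

theorem dimVec_eq_zero_of_notMem_supp {x : V} (hx : x ∉ supp T) (i : Fin m) :
    (T i).dimVec x = 0 := by
  have : Subsingleton ((T i).space x) := not_nontrivial_iff_subsingleton.1 fun h => hx ⟨i, h⟩
  rw [dimVec, Module.finrank_zero_of_subsingleton, Nat.cast_zero]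

theorem sum_smul_dimVec_nonneg {c : Fin m → ℝ} (hc : 0 ≤ c) : 0 ≤ ∑ i, c i • (T i).dimVec :=
  Finset.sum_nonneg fun i _ => smul_nonneg (hc i) (dimVec_nonneg _)

theorem exists_isTiltingSet_sum_eq (k : Type u) [Field k] [Finite V] (hQ : IsLinear Q o pos)
    {S : Set V} {d : V → ℝ} (hd : 0 ≤ d) (hdS : ∀ x ∉ S, d x = 0) :
    ∃ A : Finset ℕ, (A : Set ℕ) = pos '' S ∧ ∃ C, IsTiltingSet o A C ∧ ∃ (m : ℕ) (e : Fin m ≃ C),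
      supp (fun i => intervalRep k Q pos (e i)) = S ∧
        ∃ c : Fin m → ℝ, 0 ≤ c ∧ ∑ i, c i • (intervalRep k Q pos (e i)).dimVec = d := by
  classical
  obtain ⟨A, hA⟩ := (Set.toFinite (pos '' S)).exists_finset_coe
  have hmem (x : V) : pos x ∈ A ↔ x ∈ S := by
    rw [← Finset.mem_coe, hA, hQ.injective.mem_set_image]
  obtain ⟨C, hC, hspan⟩ := exists_isTiltingSet o A
    (Function.extend pos (fun x => (d x).toNNReal) 0) fun i hi => by
      by_cases h : i ∈ Set.range pos
      · obtain ⟨x, rfl⟩ := h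
        rw [hQ.injective.extend_apply, hdS x fun hx => hi ((hmem x).2 hx), Real.toNNReal_zero]
      · exact Function.extend_apply' _ _ _ h
  obtain ⟨c, hc⟩ := (Submodule.mem_span_image_finset_iff_exists_fun NNReal).1 hspan
  let e : Fin (Fintype.card C) ≃ C := (Fintype.equivFin C).symm
  refine ⟨A, hA, C, hC, _, e, ?_, fun i => c (e i), fun i => (c (e i)).2, ?_⟩
  · ext x
    simp only [supp, Set.mem_ofPred_eq, nontrivial_thin_iff, ← hmem]
    constructor
    · rintro ⟨i, hi⟩
      exact (hC.interval _ (e i).2).2 _ hi.1 hi.2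
    · intro hx
      obtain ⟨b, hb, hbx⟩ := hC.cover _ hx
      exact ⟨e.symm ⟨b, hb⟩, by rwa [e.apply_symm_apply]⟩
  · ext x
    have hx := congrArg NNReal.toReal (congrFun hc (pos x))
    rw [hQ.injective.extend_apply, Real.coe_toNNReal _ (hd x)] at hx
    rw [← hx, ← e.sum_comp, Finset.sum_apply, Finset.sum_apply, NNReal.coe_sum]
    refine Finset.sum_congr rfl fun i _ => ?_
    simp [dimVec_thin, intervalVec_apply, apply_ite NNReal.toReal]

theorem exists_isSupportTilting (k : Type u) [Field k] [Finite V] (hQ : IsLinear Q o pos)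
    {S : Set V} {d : V → ℝ} (hd : 0 ≤ d) (hdS : ∀ x ∉ S, d x = 0) :
    ∃ (m : ℕ) (T : Fin m → QuiverRep k Q), IsSupportTilting T ∧ supp T = S ∧
      ∃ c : Fin m → ℝ, 0 ≤ c ∧ ∑ i, c i • (T i).dimVec = d := by
  obtain ⟨A, hA, C, hC, m, e, hsupp, hsum⟩ := exists_isTiltingSet_sum_eq k hQ hd hdS
  refine ⟨m, _, isSupportTilting_of_restrict hsupp ?_, hsupp, hsum⟩
  refine isTilting_intervalRep (hQ.fullSubquiver S) ?_ hC e
  rw [hA, Set.image_eq_range]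

variable [Fintype V]

theorem Indecomposable.dropSum_dimVec (hQ : IsLinear Q o pos) {M : QuiverRep k Q}
    (hM : M.Indecomposable) : dropSum pos M.dimVec = 1 := by
  have hn (x : V) : pos x < Finset.univ.sup pos + 1 :=
    Nat.lt_succ_of_le (Finset.le_sup (Finset.mem_univ x))
  obtain ⟨r, s, hrs, -, hmem, hdim⟩ := hM.exists_interval hQ hn
  rw [funext hdim, dropSum_interval hQ.injective hrs hmem]

theorem IsTilting.dropSum_eq (hQ : IsLinear Q o pos) (hT : IsTilting T) {c : Fin m → ℝ}
    (hc : 0 ≤ c) : dropSum pos (∑ i, c i • (T i).dimVec) = ∑ i, c i := by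
  have hjump (x : V) : (∀ i, (T i).dimVec x ≤ nextEntry pos x (T i).dimVec) ∨
      ∀ i, nextEntry pos x (T i).dimVec ≤ (T i).dimVec x := by
    by_cases h : ∃ y, pos y = pos x + 1
    · obtain ⟨y, hy⟩ := h
      simp only [nextEntry_eq hQ.injective hy]
      cases ho : o (pos x)
      · obtain ⟨a⟩ := (hQ.nonempty_iff y x).2 (.inr ⟨hy.symm, ho⟩)
        exact (dimVec_le_or_le_of_rigid hT.rigid a).symm
      · obtain ⟨a⟩ := (hQ.nonempty_iff x y).2 (.inl ⟨hy.symm, ho⟩)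
        exact dimVec_le_or_le_of_rigid hT.rigid a
    · refine .inr fun i => ?_
      rw [nextEntry_eq_zero fun y hy => (h ⟨y, hy⟩).elim]
      exact dimVec_nonneg _ x
  rw [dropSum_sum_smul hc hjump]
  simp only [(hT.indecomposable _).dropSum_dimVec hQ, mul_one]

theorem IsSupportTilting.dropSum_eq (hQ : IsLinear Q o pos) (hT : IsSupportTilting T)
    {c : Fin m → ℝ} (hc : 0 ≤ c) : dropSum pos (∑ i, c i • (T i).dimVec) = ∑ i, c i := by
  classical
  rw [← dropSum_comp (f := ((↑) : supp T → V)) Subtype.val_injective (sum_smul_dimVec_nonneg hc)]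
  · rw [← IsTilting.dropSum_eq (hQ.fullSubquiver (supp T)) hT hc]
    congr 1
    ext x
    simp only [Function.comp_apply, Finset.sum_apply]
    rfl
  · intro x hx
    rw [Subtype.range_coe] at hx
    simp [dimVec_eq_zero_of_notMem_supp hx]

theorem PPlus_eq (k : Type u) [Field k] (hQ : IsLinear Q o pos) :
    PPlus k Q = {p | 0 ≤ p ∧ dropSum pos p ≤ 1} := by
  ext p
  constructor
  · rintro ⟨m, T, hT, hp⟩
    obtain ⟨c, hc, hc1, rfl⟩ := mem_convexHull_insert_zero_range.1 hp
    exact ⟨sum_smul_dimVec_nonneg hc, (hT.dropSum_eq hQ hc).trans_le hc1⟩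
  · rintro ⟨hp, hp1⟩
    obtain ⟨A, hA, C, hC, m, e, -, c, hc, rfl⟩ :=
      exists_isTiltingSet_sum_eq k hQ (S := .univ) hp fun x hx => (hx trivial).elim
    have hT := isTilting_intervalRep (k := k) hQ (by rw [hA, Set.image_univ]) hC e
    rw [hT.dropSum_eq hQ hc] at hp1
    exact ⟨m, _, hT, mem_convexHull_insert_zero_range.2 ⟨c, hc, hp1, rfl⟩⟩

theorem PFull_eq (k : Type u) [Field k] (hQ : IsLinear Q o pos) :
    PFull k Q = {p | dropSum pos p⁺ + dropSum pos p⁻ ≤ 1} := by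
  have hull {m l : ℕ} {Tp : Fin m → QuiverRep k Q} {Tm : Fin l → QuiverRep k Q} {p : V → ℝ}
      (h : IsCompl (supp Tp) (supp Tm)) := mem_convexHull_insert_zero_union_neg (p := p)
    (fun i => dimVec_nonneg (Tp i)) (fun j => dimVec_nonneg (Tm j)) fun x =>
      (em (x ∉ supp Tp)).imp dimVec_eq_zero_of_notMem_supp fun hx =>
        dimVec_eq_zero_of_notMem_supp (h.disjoint.notMem_of_mem_left (not_not.1 hx))
  ext p
  constructor
  · rintro ⟨m, l, Tp, Tm, hTp, hTm, hS, hp⟩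
    obtain ⟨c, d, hc, hd, hcd, hpc, hpd⟩ := (hull hS).1 hp
    rwa [Set.mem_ofPred_eq, hpc, hpd, hTp.dropSum_eq hQ hc, hTm.dropSum_eq hQ hd]
  · intro hp
    obtain ⟨m, Tp, hTp, hSp, c, hc, hpc⟩ := exists_isSupportTilting k hQ (S := {x | 0 < p x})
      (posPart_nonneg p) fun x hx => posPart_of_nonpos (not_lt.1 hx)
    obtain ⟨l, Tm, hTm, hSm, d, hd, hpd⟩ := exists_isSupportTilting k hQ (S := {x | 0 < p x}ᶜ)
      (negPart_nonneg p) fun x hx => negPart_of_nonneg (le_of_lt (not_not.1 hx))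
    have hS : IsCompl (supp Tp) (supp Tm) := hSp ▸ hSm ▸ isCompl_compl
    rw [Set.mem_ofPred_eq, ← hpc, ← hpd, hTp.dropSum_eq hQ hc, hTm.dropSum_eq hQ hd] at hp
    exact ⟨m, l, Tp, Tm, hTp, hTm, hS, (hull hS).2 ⟨c, d, hc, hd, hp, hpc.symm, hpd.symm⟩⟩

theorem PClus_eq (k : Type u) [Field k] [DecidableEq V] (hQ : IsLinear Q o pos) :
    PClus k Q = {p | dropSum pos p⁺ + ∑ x, p⁻ x ≤ 1} := by
  classical
  have hull {m : ℕ} {T : Fin m → QuiverRep k Q} {p : V → ℝ} :=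
    mem_convexHull_insert_zero_union_neg (p := p)
      (g := fun j : ↥(supp T)ᶜ => (Pi.single (j : V) 1 : V → ℝ)) (fun i => dimVec_nonneg (T i))
      (fun j => show (0 : V → ℝ) ≤ Pi.single ↑j 1 from Pi.single_nonneg.2 zero_le_one) fun x =>
        (em (x ∉ supp T)).imp dimVec_eq_zero_of_notMem_supp fun hx j =>
          Pi.single_eq_of_ne (fun h : x = j => j.2 (h ▸ not_not.1 hx)) 1
  ext p
  constructor
  · rintro ⟨m, T, hT, hp⟩
    rw [Set.image_eq_range] at hp
    obtain ⟨c, d, hc, -, hcd, hpc, hpd⟩ := hull.1 hp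
    rwa [Set.mem_ofPred_eq, hpc, hpd, hT.dropSum_eq hQ hc, sum_sum_smul_single_apply]
  · intro hp
    obtain ⟨m, T, hT, hS, c, hc, hpc⟩ := exists_isSupportTilting k hQ (S := {x | 0 < p x})
      (posPart_nonneg p) fun x hx => posPart_of_nonpos (not_lt.1 hx)
    have hpd := sum_coe_smul_single (S := (supp T)ᶜ) (d := p⁻) fun x hx =>
      negPart_of_nonneg (le_of_lt (hS.subset (not_not.1 hx)))
    rw [Set.mem_ofPred_eq, ← hpc, hT.dropSum_eq hQ hc, ← hpd, sum_sum_smul_single_apply] at hp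
    refine ⟨m, T, hT, ?_⟩
    rw [Set.image_eq_range]
    exact hull.2 ⟨c, _, hc, fun j => negPart_nonneg p j, hp, hpc.symm, hpd.symm⟩

end Polytopes

end QuiverRep

section ExponentialIntegral

theorem lintegral_pow_mul_exp_neg (n : ℕ) :
    ∫⁻ t in Set.Ioi (0 : ℝ), ENNReal.ofReal (Real.exp (-t)) * ENNReal.ofReal (t ^ n) =
      n.factorial := by
  have hint := Real.GammaIntegral_convergent (s := n + 1) (by positivity)
  have hGamma := Real.Gamma_eq_integral (s := n + 1) (by positivity)
  simp only [add_sub_cancel_right, Real.rpow_natCast] at hint hGamma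
  rw [← ENNReal.ofReal_natCast, ← Real.Gamma_nat_eq_factorial, hGamma,
    ofReal_integral_eq_lintegral_ofReal hint]
  · simp only [ENNReal.ofReal_mul (Real.exp_pos _).le]
  · refine ae_restrict_of_forall_mem measurableSet_Ioi fun t ht => ?_
    have ht' : 0 < t := ht
    positivity

theorem lintegral_Ici_exp_neg :
    ∫⁻ t in Set.Ici (0 : ℝ), ENNReal.ofReal (Real.exp (-t)) = 1 := by
  rw [setLIntegral_congr Ioi_ae_eq_Ici.symm]
  simpa using lintegral_pow_mul_exp_neg 0

/-- The layer cake formula, with the layers `s ≤ exp (-h)` of the integrand parametrized by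
`s = exp (-t)`. -/
theorem lintegral_exp_neg_eq_lintegral_measure_le {α : Type*} [MeasurableSpace α] (μ : Measure α)
    {h : α → ℝ} (hm : AEMeasurable h μ) :
    ∫⁻ x, ENNReal.ofReal (Real.exp (-h x)) ∂μ =
      ∫⁻ t, ENNReal.ofReal (Real.exp (-t)) * μ {x | h x ≤ t} := by
  have himage : (fun t : ℝ => Real.exp (-t)) '' Set.univ = Set.Ioi 0 := by
    rw [Set.image_univ, ← Real.range_exp]
    exact (Equiv.neg ℝ).surjective.range_comp Real.exp
  have hderiv (t : ℝ) : HasDerivWithinAt (fun t : ℝ => Real.exp (-t)) (-Real.exp (-t)) .univ t :=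
    ((hasDerivAt_neg t).exp.congr_deriv (mul_neg_one _)).hasDerivWithinAt
  have hm' : AEMeasurable (fun x => Real.exp (-h x)) μ :=
    Real.measurable_exp.comp_aemeasurable hm.neg
  rw [lintegral_eq_lintegral_meas_le μ (.of_forall fun x => (Real.exp_pos _).le) hm', ← himage,
    lintegral_image_eq_lintegral_abs_deriv_mul .univ (fun t _ => hderiv t)
      (fun s _ t _ hst => neg_injective (Real.exp_injective hst))]
  simp [abs_of_pos (Real.exp_pos _)]

variable {ι : Type*} [Fintype ι] {h : (ι → ℝ) → ℝ} {S : Set (ι → ℝ)}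

open scoped Pointwise in
theorem volume_homogeneous_le (hS : ∀ t : ℝ, 0 < t → ∀ x ∈ S, t • x ∈ S)
    (hh : ∀ t : ℝ, 0 < t → ∀ x, h (t • x) = t * h x) {t : ℝ} (ht : 0 < t) :
    volume {x ∈ S | h x ≤ t} =
      ENNReal.ofReal (t ^ Fintype.card ι) * volume {x ∈ S | h x ≤ 1} := by
  have hscale : {x ∈ S | h x ≤ t} = t • {x ∈ S | h x ≤ 1} := by
    ext x
    rw [Set.mem_smul_set_iff_inv_smul_mem₀ ht.ne', Set.mem_ofPred_eq, Set.mem_ofPred_eq,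
      hh _ (inv_pos.2 ht), inv_mul_le_one₀ ht]
    refine and_congr_left fun _ => ⟨hS _ (inv_pos.2 ht) x, fun hx => ?_⟩
    simpa [ht.ne'] using hS t ht _ hx
  rw [hscale, Measure.addHaar_smul, Module.finrank_fintype_fun_eq_card, abs_of_pos (by positivity)]

theorem factorial_mul_volume_le_one (hm : Measurable h) (hSm : MeasurableSet S)
    (hS : ∀ t : ℝ, 0 < t → ∀ x ∈ S, t • x ∈ S) (hh : ∀ t : ℝ, 0 < t → ∀ x, h (t • x) = t * h x)
    (h0 : ∀ x ∈ S, 0 ≤ h x) :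
    (Fintype.card ι).factorial * volume {x ∈ S | h x ≤ 1} =
      ∫⁻ x in S, ENNReal.ofReal (Real.exp (-h x)) := by
  have hlayer {t : ℝ} (ht : t ≠ 0) :
      ENNReal.ofReal (Real.exp (-t)) * volume.restrict S {x | h x ≤ t} =
        (Set.Ioi 0).indicator (fun t => ENNReal.ofReal (Real.exp (-t)) *
          ENNReal.ofReal (t ^ Fintype.card ι) * volume {x ∈ S | h x ≤ 1}) t := by
    have hinter : {x | h x ≤ t} ∩ S = {x ∈ S | h x ≤ t} := Set.inter_comm _ _
    rw [Measure.restrict_apply' hSm, hinter]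
    rcases ht.lt_or_gt with ht | ht
    · have hempty : {x ∈ S | h x ≤ t} = ∅ := Set.eq_empty_of_forall_notMem fun x hx =>
        (ht.trans_le (h0 x hx.1)).not_ge hx.2
      rw [hempty, measure_empty, mul_zero, Set.indicator_of_notMem (Set.notMem_Ioi.2 ht.le)]
    · rw [Set.indicator_of_mem (Set.mem_Ioi.2 ht), volume_homogeneous_le hS hh ht, mul_assoc]
  rw [lintegral_exp_neg_eq_lintegral_measure_le _ hm.aemeasurable,
    lintegral_congr_ae ((Measure.ae_ne volume 0).mono fun t => hlayer),
    lintegral_indicator measurableSet_Ioi, lintegral_mul_const _ (by fun_prop),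
    lintegral_pow_mul_exp_neg]

end ExponentialIntegral

section OrthantIntegral

variable {ι κ κ' : Type*} [Fintype ι] [Fintype κ] [Fintype κ']

theorem volume_restrict_Ici_zero :
    (volume : Measure (ι → ℝ)).restrict (Set.Ici 0) =
      Measure.pi fun _ => volume.restrict (Set.Ici 0) := by
  rw [← Set.pi_univ_Ici, volume_pi, Measure.restrict_pi_pi]
  rfl

theorem lintegral_Ici_exp_neg_sum (ι : Type*) [Fintype ι] :
    ∫⁻ x in Set.Ici (0 : ι → ℝ), ENNReal.ofReal (Real.exp (-∑ i, x i)) = 1 := by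
  have hint : IntegrableOn (fun t : ℝ => Real.exp (-t)) (Set.Ici 0) :=
    (integrableOn_Ici_iff_integrableOn_Ioi (by simp)).2 (integrableOn_exp_neg_Ioi 0)
  have hprod (x : ι → ℝ) : Real.exp (-∑ i, x i) = ∏ i, Real.exp (-x i) := by
    rw [← Finset.sum_neg_distrib, Real.exp_sum]
  simp only [hprod]
  rw [volume_restrict_Ici_zero, ← ofReal_integral_eq_lintegral_ofReal
      (.fintype_prod fun _ => hint) (.of_forall fun x => by positivity),
    integral_fintype_prod_eq_prod (fun _ t => Real.exp (-t)), integral_Ici_eq_integral_Ioi,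
    integral_exp_neg_Ioi_zero, Finset.prod_const_one, ENNReal.ofReal_one]

theorem lintegral_Ici_comp_equiv (e : κ ≃ ι) (f : (κ → ℝ) → ℝ≥0∞) :
    ∫⁻ x in Set.Ici (0 : ι → ℝ), f (x ∘ e) = ∫⁻ y in Set.Ici (0 : κ → ℝ), f y := by
  have he := (volume_measurePreserving_piCongrLeft (fun _ => ℝ) e).symm
  have hpre : (MeasurableEquiv.piCongrLeft (fun _ => ℝ) e).symm ⁻¹' Set.Ici 0 = Set.Ici 0 := by
    ext x
    exact e.forall_congr (fun _ => Iff.rfl)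
  rw [← he.setLIntegral_comp_preimage_emb (MeasurableEquiv.measurableEmbedding _), hpre]
  rfl

theorem lintegral_Ici_mul (e : κ ⊕ κ' ≃ ι) {f : (κ → ℝ) → ℝ≥0∞} {g : (κ' → ℝ) → ℝ≥0∞}
    (hf : Measurable f) (hg : Measurable g) :
    ∫⁻ x in Set.Ici (0 : ι → ℝ), f (x ∘ e ∘ Sum.inl) * g (x ∘ e ∘ Sum.inr) =
      (∫⁻ y in Set.Ici (0 : κ → ℝ), f y) * ∫⁻ z in Set.Ici (0 : κ' → ℝ), g z := by
  have hpre : MeasurableEquiv.sumPiEquivProdPi (fun _ : κ ⊕ κ' => ℝ) ⁻¹' (Set.Ici 0 ×ˢ Set.Ici 0) =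
      Set.Ici 0 := by
    ext x
    exact (Sum.forall (p := fun i => 0 ≤ x i)).symm
  refine (lintegral_Ici_comp_equiv e fun x => f (x ∘ Sum.inl) * g (x ∘ Sum.inr)).trans ?_
  rw [← hpre]
  refine ((volume_measurePreserving_sumPiEquivProdPi fun _ => ℝ).setLIntegral_comp_preimage_emb
    (MeasurableEquiv.measurableEmbedding _) (fun p => f p.1 * g p.2) _).trans ?_
  rw [Measure.volume_eq_prod, ← Measure.prod_restrict,
    lintegral_prod_mul hf.aemeasurable hg.aemeasurable]

theorem measurePreserving_piecewise_neg [DecidableEq ι] (I : Finset ι) :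
    MeasurePreserving fun x : ι → ℝ => I.piecewise x (-x) := by
  refine volume_preserving_pi (f := fun i t => if i ∈ I then t else -t) fun i => ?_
  split_ifs
  exacts [.id _, Measure.measurePreserving_neg volume]

theorem lintegral_eq_sum_orthants [DecidableEq ι] {f : (ι → ℝ) → ℝ≥0∞} (hf : Measurable f) :
    ∫⁻ x, f x = ∑ I : Finset ι, ∫⁻ x in Set.Ici 0, f (I.piecewise x (-x)) := by
  let orthant (I : Finset ι) : Set (ι → ℝ) := .pi .univ fun i => if i ∈ I then .Ici 0 else .Iio 0
  have hmem {I : Finset ι} {x : ι → ℝ} : x ∈ orthant I ↔ ∀ i, i ∈ I ↔ 0 ≤ x i := by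
    refine Set.mem_univ_pi.trans (forall_congr' fun i => ?_)
    split_ifs with hi <;> simp [hi]
  have hmeas (I : Finset ι) : MeasurableSet (orthant I) :=
    .univ_pi fun i => by split_ifs; exacts [measurableSet_Ici, measurableSet_Iio]
  have hdisj : Pairwise (Function.onFun Disjoint orthant) := fun I J hIJ =>
    Set.disjoint_left.2 fun x hI hJ =>
      hIJ (Finset.ext fun i => (hmem.1 hI i).trans (hmem.1 hJ i).symm)
  have hcover : ⋃ I, orthant I = Set.univ := Set.eq_univ_of_forall fun x =>
    Set.mem_iUnion.2 ⟨({i | 0 ≤ x i} : Finset ι), hmem.2 fun i => by simp⟩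
  have hpre (I : Finset ι) : (fun x => I.piecewise x (-x)) ⁻¹' orthant I =ᵐ[volume] Set.Ici 0 := by
    have hpi : (fun x => I.piecewise x (-x)) ⁻¹' orthant I =
        Set.univ.pi fun i => if i ∈ I then Set.Ici (0 : ℝ) else Set.Ioi 0 := by
      ext x
      refine forall₂_congr fun i _ => ?_
      by_cases hi : i ∈ I <;> simp [hi]
    rw [hpi, ← Set.pi_univ_Ici]
    refine Measure.ae_eq_set_pi fun i _ => ?_
    split_ifs
    exacts [ae_eq_rfl, Ioi_ae_eq_Ici]
  rw [← setLIntegral_univ, ← hcover, lintegral_iUnion hmeas hdisj, tsum_fintype]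
  refine Finset.sum_congr rfl fun I _ => ?_
  rw [← (measurePreserving_piecewise_neg I).setLIntegral_comp_preimage (hmeas I) hf,
    setLIntegral_congr (hpre I)]

end OrthantIntegral

section PosPartNegPart

variable {ι : Type*}

theorem posPart_smul_pi {t : ℝ} (ht : 0 ≤ t) (x : ι → ℝ) : (t • x)⁺ = t • x⁺ := by
  ext i
  simp [posPart_def, mul_max_of_nonneg _ _ ht]

theorem negPart_smul_pi {t : ℝ} (ht : 0 ≤ t) (x : ι → ℝ) : (t • x)⁻ = t • x⁻ := by
  rw [← posPart_neg, ← smul_neg, posPart_smul_pi ht, posPart_neg]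

theorem measurable_posPart_pi : Measurable fun x : ι → ℝ => x⁺ :=
  measurable_pi_lambda _ fun i => (measurable_pi_apply i).sup_const 0

theorem measurable_negPart_pi : Measurable fun x : ι → ℝ => x⁻ :=
  measurable_pi_lambda _ fun i => (measurable_pi_apply i).neg.sup_const 0

variable [DecidableEq ι]

theorem posPart_piecewise_neg (I : Finset ι) {x : ι → ℝ} (hx : 0 ≤ x) :
    (I.piecewise x (-x))⁺ = I.piecewise x (0 : ι → ℝ) := by
  ext i
  by_cases hi : i ∈ I <;> simpa [hi] using hx i

theorem negPart_piecewise_neg (I : Finset ι) {x : ι → ℝ} (hx : 0 ≤ x) :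
    (I.piecewise x (-x))⁻ = I.piecewise (0 : ι → ℝ) x := by
  ext i
  by_cases hi : i ∈ I <;> simpa [hi] using hx i

variable [Fintype ι]

theorem lintegral_posPart_mul_negPart {F G : (ι → ℝ) → ℝ≥0∞} (hF : Measurable F)
    (hG : Measurable G) {f : (I : Finset ι) → ({i // i ∈ I} → ℝ) → ℝ≥0∞}
    {g : (I : Finset ι) → ({i // i ∉ I} → ℝ) → ℝ≥0∞} (hf : ∀ I, Measurable (f I))
    (hg : ∀ I, Measurable (g I))
    (hFf : ∀ I x, 0 ≤ x → F (I.piecewise x (0 : ι → ℝ)) = f I (x ∘ (↑)))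
    (hGg : ∀ I x, 0 ≤ x → G (I.piecewise (0 : ι → ℝ) x) = g I (x ∘ (↑))) :
    ∫⁻ x, F x⁺ * G x⁻ =
      ∑ I : Finset ι, (∫⁻ y in Set.Ici 0, f I y) * ∫⁻ z in Set.Ici 0, g I z := by
  have hmeas : Measurable fun x => F x⁺ * G x⁻ :=
    (hF.comp measurable_posPart_pi).mul (hG.comp measurable_negPart_pi)
  rw [lintegral_eq_sum_orthants hmeas]
  refine Finset.sum_congr rfl fun I _ => ?_
  rw [← lintegral_Ici_mul (Equiv.sumCompl (· ∈ I)) (hf I) (hg I)]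
  refine setLIntegral_congr_fun measurableSet_Ici fun x hx => ?_
  rw [Set.mem_Ici] at hx
  simp only [posPart_piecewise_neg I hx, negPart_piecewise_neg I hx, hFf I x hx, hGg I x hx]
  rfl

theorem factorial_mul_volume_posPart_negPart_le_one {a b : (ι → ℝ) → ℝ} (ha : Measurable a)
    (hb : Measurable b) (ha_smul : ∀ t : ℝ, 0 < t → ∀ x, a (t • x) = t * a x)
    (hb_smul : ∀ t : ℝ, 0 < t → ∀ x, b (t • x) = t * b x) (ha0 : ∀ x, 0 ≤ x → 0 ≤ a x)
    (hb0 : ∀ x, 0 ≤ x → 0 ≤ b x) {a' : (I : Finset ι) → ({i // i ∈ I} → ℝ) → ℝ}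
    {b' : (I : Finset ι) → ({i // i ∉ I} → ℝ) → ℝ} (ha' : ∀ I, Measurable (a' I))
    (hb' : ∀ I, Measurable (b' I))
    (haa' : ∀ I x, 0 ≤ x → a (I.piecewise x (0 : ι → ℝ)) = a' I (x ∘ (↑)))
    (hbb' : ∀ I x, 0 ≤ x → b (I.piecewise (0 : ι → ℝ) x) = b' I (x ∘ (↑))) :
    (Fintype.card ι).factorial * volume {x | a x⁺ + b x⁻ ≤ 1} =
      ∑ I : Finset ι, (∫⁻ y in Set.Ici 0, ENNReal.ofReal (Real.exp (-a' I y))) *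
        ∫⁻ z in Set.Ici 0, ENNReal.ofReal (Real.exp (-b' I z)) := by
  have hvolume := factorial_mul_volume_le_one (S := .univ) (h := fun x => a x⁺ + b x⁻)
    ((ha.comp measurable_posPart_pi).add (hb.comp measurable_negPart_pi)) .univ
    (fun _ _ _ _ => trivial) (fun t ht x => by
      rw [posPart_smul_pi ht.le, negPart_smul_pi ht.le, ha_smul t ht, hb_smul t ht, mul_add])
    fun x _ => add_nonneg (ha0 _ (posPart_nonneg x)) (hb0 _ (negPart_nonneg x))
  simp only [Set.mem_univ, true_and, Measure.restrict_univ, neg_add, Real.exp_add,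
    ENNReal.ofReal_mul (Real.exp_pos _).le] at hvolume
  rw [hvolume]
  exact lintegral_posPart_mul_negPart (F := fun x => ENNReal.ofReal (Real.exp (-a x)))
    (G := fun x => ENNReal.ofReal (Real.exp (-b x))) (by fun_prop) (by fun_prop)
    (fun I => by fun_prop) (fun I => by fun_prop) (fun I x hx => by rw [haa' I x hx])
    fun I x hx => by rw [hbb' I x hx]

end PosPartNegPart

section DropIntegral

variable {V W : Type*} [Fintype V] [Fintype W] {pos : V → ℕ} {pos' : W → ℕ}

/-- The integral of `exp (-dropSum pos)` over the nonnegative orthant. It is the integral volume of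
the part of this orthant where `dropSum pos ≤ 1`. -/
noncomputable def dropIntegral (pos : V → ℕ) : ℝ≥0∞ :=
  ∫⁻ x in Set.Ici (0 : V → ℝ), ENNReal.ofReal (Real.exp (-dropSum pos x))

theorem dropIntegral_of_isEmpty [IsEmpty V] (pos : V → ℕ) : dropIntegral pos = 1 := by
  rw [dropIntegral, ← lintegral_Ici_exp_neg_sum V]
  simp [dropSum]

theorem dropIntegral_comp_equiv (pos : V → ℕ) (e : W ≃ V) :
    dropIntegral (pos ∘ e) = dropIntegral pos := by
  rw [dropIntegral, ← lintegral_Ici_comp_equiv e]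
  refine setLIntegral_congr_fun measurableSet_Ici fun x hx => ?_
  rw [dropSum_comp e.injective hx fun y hy => (hy (e.surjective y)).elim]

theorem dropIntegral_congr (hpos : Function.Injective pos) (hpos' : Function.Injective pos')
    (h : Set.range pos = Set.range pos') : dropIntegral pos = dropIntegral pos' := by
  let e : V ≃ W := (Equiv.ofInjective pos hpos).trans
    ((Equiv.setCongr h).trans (Equiv.ofInjective pos' hpos').symm)
  have hcomp : pos = pos' ∘ e := by
    ext x
    simp [e, Equiv.apply_ofInjective_symm]
  rw [hcomp, dropIntegral_comp_equiv]

theorem dropIntegral_add_right (pos : V → ℕ) (c : ℕ) :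
    dropIntegral (fun x => pos x + c) = dropIntegral pos := by
  simp only [dropIntegral, dropSum_add_right]

theorem dropIntegral_sumElim (h : ∀ x y, pos x + 1 < pos' y) :
    dropIntegral (Sum.elim pos pos') = dropIntegral pos * dropIntegral pos' := by
  rw [dropIntegral, dropIntegral, dropIntegral, ← lintegral_Ici_mul (Equiv.refl _) (by fun_prop)
    (by fun_prop)]
  simp only [dropSum_sumElim h, neg_add, Real.exp_add, ENNReal.ofReal_mul (Real.exp_pos _).le]
  rfl

end DropIntegral

section IntegralVolume

variable {V : Type v} [Fintype V] {Q : Quiver.{w} V} {o : ℕ → Bool} {pos : V → ℕ}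

theorem tPlus_eq_dropIntegral (k : Type u) [Field k] (hQ : IsLinear Q o pos) :
    tPlus k Q = dropIntegral pos := by
  rw [tPlus, integralVolume, QuiverRep.PPlus_eq k hQ]
  exact factorial_mul_volume_le_one (by fun_prop) measurableSet_Ici
    (fun t ht x (hx : 0 ≤ x) => smul_nonneg ht.le hx) (fun t ht => dropSum_smul ht.le)
    fun x _ => dropSum_nonneg pos x

theorem dropSum_piecewise_zero_right [DecidableEq V] (pos : V → ℕ) (I : Finset V) {x : V → ℝ}
    (hx : 0 ≤ x) : dropSum pos (I.piecewise x (0 : V → ℝ)) =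
      dropSum (fun y : {y // y ∈ I} => pos y) (x ∘ (↑)) := by
  have hnonneg : 0 ≤ I.piecewise x (0 : V → ℝ) := I.le_piecewise_of_le_of_le hx le_rfl
  rw [← dropSum_comp Subtype.val_injective hnonneg fun y hy =>
    I.piecewise_eq_of_notMem _ _ fun hyI => hy ⟨⟨y, hyI⟩, rfl⟩]
  exact congrArg _ (funext fun y => I.piecewise_eq_of_mem _ _ y.2)

theorem dropSum_piecewise_zero_left [DecidableEq V] (pos : V → ℕ) (I : Finset V) {x : V → ℝ}
    (hx : 0 ≤ x) : dropSum pos (I.piecewise (0 : V → ℝ) x) =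
      dropSum (fun y : {y // y ∉ I} => pos y) (x ∘ (↑)) := by
  have hnonneg : 0 ≤ I.piecewise (0 : V → ℝ) x := I.le_piecewise_of_le_of_le le_rfl hx
  rw [← dropSum_comp Subtype.val_injective hnonneg fun y hy =>
    I.piecewise_eq_of_mem _ _ (not_not.1 fun hyI => hy ⟨⟨y, hyI⟩, rfl⟩)]
  exact congrArg _ (funext fun y => I.piecewise_eq_of_notMem _ _ y.2)

theorem sum_piecewise_zero_left [DecidableEq V] (I : Finset V) (x : V → ℝ) :
    ∑ y, I.piecewise (0 : V → ℝ) x y = ∑ y : {y // y ∉ I}, x y :=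
  (Fintype.sum_of_injective _ Subtype.val_injective _ _
    (fun y hy => I.piecewise_eq_of_mem _ _ (not_not.1 fun hyI => hy ⟨⟨y, hyI⟩, rfl⟩))
    fun y => (I.piecewise_eq_of_notMem _ _ y.2).symm).symm

theorem tFull_eq_sum_dropIntegral [DecidableEq V] (k : Type u) [Field k] (hQ : IsLinear Q o pos) :
    tFull k Q = ∑ I : Finset V,
      dropIntegral (fun x : {x // x ∈ I} => pos x) *
        dropIntegral (fun x : {x // x ∉ I} => pos x) := by
  have hsmul (t : ℝ) (ht : 0 < t) := dropSum_smul (pos := pos) ht.le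
  rw [tFull, integralVolume, QuiverRep.PFull_eq k hQ]
  exact factorial_mul_volume_posPart_negPart_le_one (by fun_prop) (by fun_prop) hsmul hsmul
    (fun _ _ => dropSum_nonneg _ _) (fun _ _ => dropSum_nonneg _ _) (fun _ => by fun_prop)
    (fun _ => by fun_prop) (fun I _ => dropSum_piecewise_zero_right pos I)
    fun I _ => dropSum_piecewise_zero_left pos I

theorem tClus_eq_sum_dropIntegral [DecidableEq V] (k : Type u) [Field k] (hQ : IsLinear Q o pos) :
    tClus k Q = ∑ I : Finset V, dropIntegral (fun x : {x // x ∈ I} => pos x) := by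
  rw [tClus, integralVolume, QuiverRep.PClus_eq k hQ, factorial_mul_volume_posPart_negPart_le_one
    (b := fun x => ∑ y, x y) (b' := fun I x => ∑ y, x y) (by fun_prop) (by fun_prop)
    (fun t ht => dropSum_smul ht.le) (fun t _ x => (Finset.mul_sum _ _ _).symm)
    (fun _ _ => dropSum_nonneg _ _) (fun _ hx => Finset.sum_nonneg fun y _ => hx y)
    (fun _ => by fun_prop) (fun _ => by fun_prop)
    (fun I _ => dropSum_piecewise_zero_right pos I) fun I x _ => sum_piecewise_zero_left I x]
  simp only [lintegral_Ici_exp_neg_sum, mul_one]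
  rfl

end IntegralVolume

section LeastEntry

variable {n : ℕ}

theorem volume_apply_eq_apply {ι : Type*} [Fintype ι] {i j : ι} (hij : i ≠ j) :
    volume {x : ι → ℝ | x i = x j} = 0 := by
  classical
  let ℓ : (ι → ℝ) →ₗ[ℝ] ℝ := LinearMap.proj (R := ℝ) (φ := fun _ => ℝ) i - LinearMap.proj j
  have hker : (ℓ.ker : Set (ι → ℝ)) = {x | x i = x j} := by
    ext x
    simp [ℓ, sub_eq_zero]
  rw [← hker]
  refine Measure.addHaar_submodule _ _ fun htop => ?_
  have hsingle : ℓ (Pi.single i 1) = 0 := LinearMap.mem_ker.1 (htop ▸ Submodule.mem_top)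
  simp [ℓ, hij.symm] at hsingle

theorem measurePreserving_insertNth_add (i : Fin (n + 1)) :
    MeasurePreserving fun p : ℝ × (Fin n → ℝ) =>
      (i.insertNth p.1 (p.2 + Function.const _ p.1) : Fin (n + 1) → ℝ) := by
  have hshear : MeasurePreserving fun p : ℝ × (Fin n → ℝ) => (p.1, p.2 + Function.const _ p.1) :=
    (MeasurePreserving.id volume).skew_product
      (g := fun (t : ℝ) (y : Fin n → ℝ) => y + Function.const (Fin n) t) (by fun_prop)
      (.of_forall fun t => (measurePreserving_add_right volume _).map_eq)
  exact (volume_preserving_piFinSuccAbove (fun _ => ℝ) i).symm.comp hshear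

theorem lintegral_Ici_eq_sum_insertNth_add {f : (Fin (n + 1) → ℝ) → ℝ≥0∞} (hf : Measurable f) :
    ∫⁻ x in Set.Ici 0, f x =
      ∑ i : Fin (n + 1), ∫⁻ p in Set.Ici (0 : ℝ) ×ˢ Set.Ici (0 : Fin n → ℝ),
        f (i.insertNth p.1 (p.2 + Function.const _ p.1)) := by
  let least (i : Fin (n + 1)) : Set (Fin (n + 1) → ℝ) := {x | 0 ≤ x i ∧ ∀ j, x i ≤ x j}
  have hmeas (i : Fin (n + 1)) : MeasurableSet (least i) := by
    have hi : least i = {x | 0 ≤ x i} ∩ ⋂ j, {x | x i ≤ x j} := by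
      ext x
      simp [least]
    rw [hi]
    exact (measurableSet_le measurable_const (measurable_pi_apply i)).inter
      (.iInter fun j => measurableSet_le (measurable_pi_apply i) (measurable_pi_apply j))
  have hdisj : Pairwise (Function.onFun (AEDisjoint volume) least) := fun i j hij =>
    measure_mono_null (fun x hx => le_antisymm (hx.1.2 j) (hx.2.2 i)) (volume_apply_eq_apply hij)
  have hcover : ⋃ i, least i = Set.Ici 0 := by
    ext x
    refine Set.mem_iUnion.trans ⟨fun ⟨i, hi, hij⟩ j => hi.trans (hij j), fun hx => ?_⟩
    obtain ⟨i, hi⟩ := Finite.exists_min x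
    exact ⟨i, hx i, hi⟩
  rw [← hcover, lintegral_iUnion₀ (fun i => (hmeas i).nullMeasurableSet) hdisj, tsum_fintype]
  refine Finset.sum_congr rfl fun i _ => ?_
  rw [← (measurePreserving_insertNth_add i).setLIntegral_comp_preimage (hmeas i) hf]
  congr 2
  ext p
  simp [least, Fin.forall_iff_succAbove i, Prod.le_def, Pi.le_def]

end LeastEntry

section DropIntegralRecursion

variable {n : ℕ}

theorem dropSum_fin (x : Fin (n + 1) → ℝ) :
    dropSum Fin.val x = ∑ i : Fin n, (x i.castSucc - x i.succ)⁺ + (x (Fin.last n))⁺ := by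
  have hlast : nextEntry Fin.val (Fin.last n) x = 0 :=
    nextEntry_eq_zero fun y hy => by simp at hy; omega
  have hsucc (i : Fin n) : nextEntry Fin.val i.castSucc x = x i.succ :=
    nextEntry_eq Fin.val_injective (by simp) x
  simp only [dropSum, Fin.sum_univ_castSucc, hlast, hsucc, sub_zero]

theorem dropSum_fin_add_const {x : Fin (n + 1) → ℝ} (hx : 0 ≤ x) {t : ℝ} (ht : 0 ≤ t) :
    dropSum Fin.val (x + Function.const _ t) = t + dropSum Fin.val x := by
  have hlast : 0 ≤ x (Fin.last n) := hx _
  simp only [dropSum_fin, Pi.add_apply, Function.const_apply, add_sub_add_right_eq_sub,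
    posPart_of_nonneg hlast, posPart_of_nonneg (add_nonneg hlast ht)]
  ring

theorem dropSum_fin_insertNth_add (i : Fin (n + 1)) {t : ℝ} (ht : 0 ≤ t) {y : Fin n → ℝ}
    (hy : 0 ≤ y) :
    dropSum Fin.val (i.insertNth t (y + Function.const _ t) : Fin (n + 1) → ℝ) =
      t + dropSum (Fin.val ∘ i.succAbove) y := by
  have hshift : (i.insertNth t (y + Function.const _ t) : Fin (n + 1) → ℝ) =
      i.insertNth 0 y + Function.const _ t := by
    refine funext (i.forall_iff_succAbove.2 ⟨?_, fun j => ?_⟩) <;> simp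
  have hnonneg : (0 : Fin (n + 1) → ℝ) ≤ i.insertNth 0 y :=
    i.forall_iff_succAbove.2 ⟨by simp, fun j => by simpa using hy j⟩
  rw [hshift, dropSum_fin_add_const hnonneg ht,
    ← dropSum_comp i.succAbove_right_injective hnonneg fun j hj => ?_]
  · congr 2
    ext j
    simp
  · rw [not_not.1 fun hji : j ≠ i => hj (Fin.exists_succAbove_eq hji)]
    simp

theorem dropIntegral_fin_succ (n : ℕ) :
    dropIntegral (Fin.val : Fin (n + 1) → ℕ) =
      ∑ i : Fin (n + 1), dropIntegral (Fin.val ∘ i.succAbove : Fin n → ℕ) := by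
  rw [dropIntegral, lintegral_Ici_eq_sum_insertNth_add (by fun_prop)]
  refine Finset.sum_congr rfl fun i _ => ?_
  have hsplit : Set.EqOn
      (fun p : ℝ × (Fin n → ℝ) => ENNReal.ofReal (Real.exp
        (-dropSum Fin.val (i.insertNth p.1 (p.2 + Function.const _ p.1) : Fin (n + 1) → ℝ))))
      (fun p => ENNReal.ofReal (Real.exp (-p.1)) *
        ENNReal.ofReal (Real.exp (-dropSum (Fin.val ∘ i.succAbove) p.2)))
      (Set.Ici 0 ×ˢ Set.Ici 0) := fun p hp => by
    simp only [dropSum_fin_insertNth_add i hp.1 hp.2, neg_add, Real.exp_add,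
      ENNReal.ofReal_mul (Real.exp_pos _).le]
  rw [setLIntegral_congr_fun (measurableSet_Ici.prod measurableSet_Ici) hsplit,
    Measure.volume_eq_prod, ← Measure.prod_restrict,
    lintegral_prod_mul (f := fun t => ENNReal.ofReal (Real.exp (-t)))
      (g := fun y => ENNReal.ofReal (Real.exp (-dropSum (Fin.val ∘ i.succAbove) y)))
      (by fun_prop) (by fun_prop), lintegral_Ici_exp_neg, one_mul]
  rfl

theorem dropIntegral_succAbove (i : Fin (n + 1)) :
    dropIntegral (Fin.val ∘ i.succAbove : Fin n → ℕ) =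
      dropIntegral (Fin.val : Fin i → ℕ) * dropIntegral (Fin.val : Fin (n - i) → ℕ) := by
  rw [← dropIntegral_add_right (Fin.val : Fin (n - i) → ℕ) (i + 1),
    ← dropIntegral_sumElim fun x y => by omega]
  refine dropIntegral_congr (Fin.val_injective.comp i.succAbove_right_injective) ?_ ?_
  · refine Fin.val_injective.sumElim (fun a b h => Fin.ext (by simpa using h)) fun a b => by omega
  · ext m
    rw [Set.Sum.elim_range, Set.range_comp, Fin.range_succAbove]
    simp only [Set.mem_image, Set.mem_compl_singleton_iff, Set.mem_union, Set.mem_range]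
    constructor
    · rintro ⟨x, hx, rfl⟩
      rcases lt_or_gt_of_ne hx with hxi | hix
      · exact .inl ⟨⟨x, hxi⟩, rfl⟩
      · exact .inr ⟨⟨x - (i + 1), by omega⟩, Nat.sub_add_cancel hix⟩
    · rintro (⟨x, rfl⟩ | ⟨y, rfl⟩)
      · exact ⟨x.castLE (by omega), Fin.ne_of_lt x.isLt, rfl⟩
      · exact ⟨⟨y + (i + 1), by omega⟩, Fin.ne_of_gt (by simp [Fin.lt_def]; omega), rfl⟩

end DropIntegralRecursion

section PowersetRecursion

open Finset

variable {R : Type*} [CommSemiring R] {t : Finset ℕ → R}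

theorem sum_powerset_range_union_Ico
    (ht : ∀ n m, ∀ J ⊆ range n, t (J ∪ Ico (n + 1) (n + 1 + m)) = t J * t (range m)) (n m : ℕ) :
    ∑ J ∈ (range n).powerset, t (J ∪ Ico n (n + m)) =
      t (range (n + m)) +
        ∑ i ∈ range n, (∑ J ∈ (range i).powerset, t J) * t (range (n + m - 1 - i)) := by
  induction n generalizing m with
  | zero =>
    rw [range_zero, powerset_empty, sum_singleton, empty_union, sum_empty, add_zero, range_eq_Ico]
  | succ n ih =>
    have habsent : ∑ J ∈ (range n).powerset, t (J ∪ Ico (n + 1) (n + 1 + m)) =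
        (∑ J ∈ (range n).powerset, t J) * t (range m) := by
      rw [sum_mul]
      exact sum_congr rfl fun J hJ => ht n m J (mem_powerset.1 hJ)
    have hpresent : ∑ J ∈ (range n).powerset, t (insert n J ∪ Ico (n + 1) (n + 1 + m)) =
        ∑ J ∈ (range n).powerset, t (J ∪ Ico n (n + (m + 1))) := by
      refine sum_congr rfl fun J _ => congrArg t ?_
      ext x
      grind
    have hlast : n + (m + 1) - 1 - n = m := by omega
    rw [range_add_one, sum_powerset_insert notMem_range_self, habsent, hpresent, ih,
      sum_insert notMem_range_self, add_right_comm n 1 m, add_assoc n m 1, hlast]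
    ring

theorem sum_powerset_range_eq (hempty : t ∅ = 1)
    (ht : ∀ n m, ∀ J ⊆ range n, t (J ∪ Ico (n + 1) (n + 1 + m)) = t J * t (range m))
    (hsucc : ∀ n, t (range (n + 1)) = ∑ i ∈ range (n + 1), t (range i) * t (range (n - i)))
    (n : ℕ) : ∑ J ∈ (range n).powerset, t J = t (range (n + 1)) := by
  induction n using Nat.strong_induction_on with
  | h n ih =>
    have hsplit := sum_powerset_range_union_Ico ht n 0
    simp only [add_zero, Ico_self, union_empty] at hsplit
    rw [hsplit, hsucc, sum_range_succ', range_zero, hempty, one_mul, Nat.sub_zero, add_comm]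
    refine congrArg (· + _) (sum_congr rfl fun i hi => ?_)
    rw [ih i (mem_range.1 hi), Nat.sub_sub, add_comm 1 i]

end PowersetRecursion

section TypeA

theorem dropIntegral_range (n : ℕ) :
    dropIntegral (Subtype.val : Finset.range n → ℕ) = dropIntegral (Fin.val : Fin n → ℕ) :=
  dropIntegral_congr Subtype.val_injective Fin.val_injective (by ext; simp)

theorem dropIntegral_union_Ico (n m : ℕ) {J : Finset ℕ} (hJ : J ⊆ Finset.range n) :
    dropIntegral (Subtype.val : ↥(J ∪ Finset.Ico (n + 1) (n + 1 + m)) → ℕ) =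
      dropIntegral (Subtype.val : J → ℕ) * dropIntegral (Subtype.val : Finset.range m → ℕ) := by
  have hlt (x : J) : (x : ℕ) < n := Finset.mem_range.1 (hJ x.2)
  rw [← dropIntegral_add_right (Subtype.val : Finset.range m → ℕ) (n + 1),
    ← dropIntegral_sumElim fun x y => by have := hlt x; omega]
  refine dropIntegral_congr Subtype.val_injective ?_ ?_
  · exact Subtype.val_injective.sumElim (fun a b h => Subtype.ext (by simpa using h))
      fun a b => by have := hlt a; omega
  · rw [Set.Sum.elim_range, Subtype.range_coe, Subtype.range_coe, Finset.coe_union]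
    refine congrArg _ (Set.ext fun x => ?_)
    simp only [Finset.coe_Ico, Set.mem_Ico, Set.mem_range, Subtype.exists, Finset.mem_range]
    exact ⟨fun hx => ⟨x - (n + 1), by omega, by omega⟩, by rintro ⟨y, hy, rfl⟩; omega⟩

theorem dropIntegral_fin_succ_eq_sum_range (n : ℕ) :
    dropIntegral (Fin.val : Fin (n + 1) → ℕ) = ∑ i ∈ Finset.range (n + 1),
      dropIntegral (Fin.val : Fin i → ℕ) * dropIntegral (Fin.val : Fin (n - i) → ℕ) := by
  rw [dropIntegral_fin_succ, Finset.sum_range]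
  exact Finset.sum_congr rfl fun i _ => dropIntegral_succAbove i

theorem sum_dropIntegral_subtype_fin (n : ℕ) :
    ∑ I : Finset (Fin n), dropIntegral (fun x : {x // x ∈ I} => (x : ℕ)) =
      dropIntegral (Fin.val : Fin (n + 1) → ℕ) := by
  have hpowerset : (Finset.range n).powerset =
      Finset.univ.image fun I : Finset (Fin n) => I.image Fin.val := by
    have hrange : Finset.univ.image (Fin.val : Fin n → ℕ) = Finset.range n := by
      ext x
      simp [Fin.exists_iff]
    rw [← hrange, Finset.powerset_image, Finset.powerset_univ]
  have hrec := sum_powerset_range_eq (t := fun J => dropIntegral (Subtype.val : J → ℕ))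
    (dropIntegral_of_isEmpty _) (fun n m J => dropIntegral_union_Ico n m)
    (fun n => by simpa only [dropIntegral_range] using dropIntegral_fin_succ_eq_sum_range n) n
  rw [← dropIntegral_range, ← hrec, hpowerset,
    Finset.sum_image (Finset.image_injective Fin.val_injective).injOn]
  refine Finset.sum_congr rfl fun I _ => dropIntegral_congr
    (Fin.val_injective.comp Subtype.val_injective) Subtype.val_injective ?_
  ext
  simp

variable (k : Type u) [Field k] (o : ℕ → Bool) (n : ℕ)

theorem tPlus_typeA : tPlus k (typeA n o) = dropIntegral (Fin.val : Fin n → ℕ) :=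
  tPlus_eq_dropIntegral k (isLinear_typeA n o)

theorem tPlus_fullSubquiver_typeA (S : Set (Fin n)) [Fintype S] {W : Type*} [Fintype W]
    {pos : W → ℕ} (hpos : Function.Injective pos) (hrange : Set.range pos = Fin.val '' S) :
    tPlus k (fullSubquiver (typeA n o) S) = dropIntegral pos := by
  have hQ := (isLinear_typeA n o).fullSubquiver S
  rw [tPlus_eq_dropIntegral k hQ]
  refine dropIntegral_congr hQ.injective hpos ?_
  rw [hrange, Set.image_eq_range]

theorem tPlus_fullSubquiver_typeA_coe (I : Finset (Fin n)) :
    tPlus k (fullSubquiver (typeA n o) (I : Set (Fin n))) =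
      dropIntegral (fun x : {x // x ∈ I} => (x : ℕ)) :=
  tPlus_fullSubquiver_typeA k o n _ (Fin.val_injective.comp Subtype.val_injective)
    (Set.image_eq_range _ _).symm

theorem tPlus_fullSubquiver_typeA_coe_compl (I : Finset (Fin n)) :
    tPlus k (fullSubquiver (typeA n o) ((Iᶜ : Finset (Fin n)) : Set (Fin n))) =
      dropIntegral (fun x : {x // x ∉ I} => (x : ℕ)) := by
  refine tPlus_fullSubquiver_typeA k o n _ (Fin.val_injective.comp Subtype.val_injective) ?_
  rw [Finset.coe_compl, Set.image_eq_range]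
  rfl

theorem tPlus_fullSubquiver_typeA_compl_singleton (i : Fin (n + 1)) :
    tPlus k (fullSubquiver (typeA (n + 1) o)
        (({i}ᶜ : Finset (Fin (n + 1))) : Set (Fin (n + 1)))) =
      dropIntegral (Fin.val ∘ i.succAbove : Fin n → ℕ) := by
  refine tPlus_fullSubquiver_typeA k o _ _
    (Fin.val_injective.comp i.succAbove_right_injective) ?_
  rw [Set.range_comp, Fin.range_succAbove, Finset.coe_compl, Finset.coe_singleton]

theorem tFull_typeA :
    tFull k (typeA n o) = ∑ I : Finset (Fin n),
      tPlus k (fullSubquiver (typeA n o) (I : Set (Fin n))) *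
        tPlus k (fullSubquiver (typeA n o) ((Iᶜ : Finset (Fin n)) : Set (Fin n))) := by
  refine (tFull_eq_sum_dropIntegral k (isLinear_typeA n o)).trans
    (Finset.sum_congr rfl fun I _ => ?_)
  rw [tPlus_fullSubquiver_typeA_coe_compl, tPlus_fullSubquiver_typeA_coe]

theorem tClus_typeA :
    tClus k (typeA n o) = dropIntegral (Fin.val : Fin (n + 1) → ℕ) :=
  (tClus_eq_sum_dropIntegral k (isLinear_typeA n o)).trans (sum_dropIntegral_subtype_fin n)

theorem tClus_typeA_eq_sum :
    tClus k (typeA n o) = ∑ I : Finset (Fin n),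
      tPlus k (fullSubquiver (typeA n o) ((Iᶜ : Finset (Fin n)) : Set (Fin n))) := by
  refine (tClus_eq_sum_dropIntegral k (isLinear_typeA n o)).trans ?_
  simp only [← tPlus_fullSubquiver_typeA_coe k o n]
  exact (Equiv.sum_comp (compl_involutive.toPerm compl) fun I : Finset (Fin n) =>
    tPlus k (fullSubquiver (typeA n o) (I : Set (Fin n)))).symm

end TypeA

theorem mainTheorem4 (k : Type*) [Field k] (o : ℕ → ℕ → Bool) (n : ℕ) (hn : 1 ≤ n) :
    (tFull k (typeA n (o n)) =
      ∑ I : Finset (Fin n),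
        tPlus k (fullSubquiver (typeA n (o n)) (I : Set (Fin n))) *
          tPlus k (fullSubquiver (typeA n (o n)) ((Iᶜ : Finset (Fin n)) : Set (Fin n)))) ∧
    (tClus k (typeA n (o n)) =
        ∑ I : Finset (Fin n),
          tPlus k (fullSubquiver (typeA n (o n)) ((Iᶜ : Finset (Fin n)) : Set (Fin n))) ∧
      tClus k (typeA n (o n)) =
        ∑ i ∈ Finset.range (n + 1),
          tPlus k (typeA i (o i)) * tPlus k (typeA (n - i) (o (n - i)))) ∧
    (tPlus k (typeA n (o n)) =
        ∑ i : Fin n,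
          tPlus k (fullSubquiver (typeA n (o n)) ((({i} : Finset (Fin n))ᶜ : Finset (Fin n)) :
            Set (Fin n))) ∧
      tPlus k (typeA n (o n)) =
        ∑ i ∈ Finset.range n,
          tPlus k (typeA i (o i)) * tPlus k (typeA (n - 1 - i) (o (n - 1 - i)))) := by
  obtain ⟨n, rfl⟩ := Nat.exists_eq_add_of_le' hn
  refine ⟨tFull_typeA k _ _, ⟨tClus_typeA_eq_sum k _ _, ?_⟩, ?_, ?_⟩
  · simp only [tClus_typeA, tPlus_typeA, dropIntegral_fin_succ_eq_sum_range (n + 1)]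
  · simp only [tPlus_typeA, tPlus_fullSubquiver_typeA_compl_singleton, dropIntegral_fin_succ n]
  · simp only [tPlus_typeA, dropIntegral_fin_succ_eq_sum_range n]
    rfl
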